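/- **Setting.** Let $(X,d,\mu)$ be a metric measure space, i.e. a metric space with a Borel measure such that $0<\mu(B(x,r))<\infty$ for all $x\in X$, $r>0$, and assume that $X$ is bounded. A function $q:X\to(0,\infty)$ is called a *bounded log-Hölder exponent* (written $q\in\mathcal P_b^{\log}(X)$) if it is measurable, essentially bounded, $\operatorname{ess\,inf} q>0$, and there is $L>0$ with $\left|\frac1{q(x)}-\frac1{q(y)}\right|\le \frac{L}{\log(e+1/d(x,y))}$ for all $x\ne y$. For exponents write $q\ll r$ (or $r\gg q$) if $\operatorname{ess\,inf}(r-q)>0$. For such $q$, $L^{q(\cdot)}(X)$ is the space of measurable $f$ with $\int_X|f|^{q(x)}\,d\mu<\infty$, with quasi-norm $\|f\|_{L^{q(\cdot)}}=\inf\{\lambda>0:\int_X|f/\lambda|^{q(x)}\,d\mu\le1\}$. For a measurable, a.e. finite $u:X\to[-\infty,\infty]$, $\mathcal D^{s(\cdot)}(u)$ is the set of functions $g:X\to[0,\infty]$ for which there is a null set $N$ with $|u(x)-u(y)|\le d(x,y)^{s(x)}g(x)+d(x,y)^{s(y)}g(y)$ for all $x,y\in X\setminus N$. The space $\dot M^{s(\cdot),p(\cdot)}(X)$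 consists of those $u$ with $\mathcal D^{s(\cdot)}(u)\cap L^{p(\cdot)}(X)\neq\emptyset$, and $M^{s(\cdot),p(\cdot)}(X)=\dot M^{s(\cdot),p(\cdot)}(X)\cap L^{p(\cdot)}(X)$. Finally $u_X=\frac1{\mu(X)}\int_X u\,d\mu$. **Theorem.** Let $(X,d,\mu)$ be a bounded metric measure space, and let $Q\in\mathcal P_b^{\log}(X)$, $\delta\in(0,\infty)$, $b\in(0,1]$ be such that $\mu(B(x,r))\ge b\,r^{Q(x)}$ for all $x\in X$ and $r\in(0,\delta]$. Let $p,s\in\mathcal P_b^{\log}(X)$. In the following, dependence of a constant on $p,s,Q$ means dependence only on positive lower bounds for their essential infima, upper bounds for their essential suprema, log-Hölder constants of $1/p,1/s,1/Q$, and, in (i) and (iii), a positive lower bound for $\operatorname{ess\,inf}(Q-sp)$, respectively $\operatorname{ess\,inf}(sp-Q)$. (i) If $sp\ll Q$ and $\gamma:=\frac{Qp}{Q-sp}$, there is a constant $\hat C_S>0$, depending only on $b,\delta,\operatorname{diam}X,\mu(X),p,s,Q$, such that for all $u\in\dot M^{s(\cdot),p(\cdot)}(X)$ and $g\in\mathcal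 D^{s(\cdot)}(u)\cap L^{p(\cdot)}(X)$ $$\inf_{c\in\mathbb R}\|u-c\|_{L^{\gamma(\cdot)}(X)}\le\hat C_S\|g\|_{L^{p(\cdot)}(X)},$$ and for all $u\in M^{s(\cdot),p(\cdot)}(X)$ and $g\in\mathcal D^{s(\cdot)}(u)\cap L^{p(\cdot)}(X)$ $$\|u\|_{L^{\gamma(\cdot)}(X)}\le\hat C_S\left(\|u\|_{L^{p(\cdot)}(X)}+\|g\|_{L^{p(\cdot)}(X)}\right).$$ (ii) If $sp=Q$, there are constants $\hat C_{MT1},\hat C_{MT2}>0$, depending only on $b,\delta,\operatorname{diam}X,p,s,Q$, such that for all $u\in\dot M^{s(\cdot),p(\cdot)}(X)$ and $g\in\mathcal D^{s(\cdot)}(u)\cap L^{p(\cdot)}(X)$ the function $u$ is integrable on $X$ and, if $\|g\|_{L^{p(\cdot)}(X)}>0$, $$\frac1{\mu(X)}\int_X\exp\left(\hat C_{MT1}\frac{|u(x)-u_X|}{\|g\|_{L^{p(\cdot)}(X)}}\right)d\mu(x)\le\hat C_{MT2}.$$ (iii) If $sp\gg Q$ and $\alpha:=s-\frac Qp$, there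 are constants $\hat C_H,\hat D_H>0$, depending only on $b,\delta,\operatorname{diam}X,p,s,Q$, such that for all $u\in\dot M^{s(\cdot),p(\cdot)}(X)$ and $g\in\mathcal D^{s(\cdot)}(u)\cap L^{p(\cdot)}(X)$ the function $u$ is integrable on $X$, $$\|u-u_X\|_{L^\infty(X)}\le\hat C_H\|g\|_{L^{p(\cdot)}(X)},$$ and there is a continuous $\tilde u:X\to\mathbb R$ with $\tilde u=u$ a.e. such that for all $x,y\in X$ $$|\tilde u(x)-\tilde u(y)|\le\hat D_H\,\|g\|_{L^{p(\cdot)}(X)}\,d(x,y)^{\alpha(x)}.$$ -/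

import Mathlib

open MeasureTheory Set
open scoped ENNReal

universe v

namespace VarExp

variable {X : Type*}

/-- A metric measure space: every ball of positive radius has positive and finite measure. -/
def IsMetricMeasure [MetricSpace X] [MeasurableSpace X] (μ : Measure X) : Prop :=
  ∀ (x : X) (r : ℝ), 0 < r → 0 < μ (Metric.ball x r) ∧ μ (Metric.ball x r) < ∞

/-- The lower bound `μ (B(x,r)) ≥ b * r ^ Q(x)` for all points `x` and all radii `0 < r ≤ δ`. -/
def LowerRegular [MetricSpace X] [MeasurableSpace X] (μ : Measure X) (Q : X → ℝ) (b δ : ℝ) :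
    Prop :=
  ∀ (x : X) (r : ℝ), 0 < r → r ≤ δ → ENNReal.ofReal (b * r ^ Q x) ≤ μ (Metric.ball x r)

/-- `f` is locally log-Hölder continuous on `X` with constant `L`.
(For `x = y` the condition is trivial, as the left side is `0`.) -/
def LogHolderWith [MetricSpace X] (L : ℝ) (f : X → ℝ) : Prop :=
  0 < L ∧ ∀ x y : X, |f x - f y| ≤ L / Real.log (Real.exp 1 + 1 / dist x y)

/-- Numerical data controlling a bounded log-Hölder exponent `p`: a lower bound for the essential
infimum, an upper bound for the essential supremum, a log-Hölder constant of `1 / p`. -/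
structure ExpBounds where
  lower : ℝ
  upper : ℝ
  logConst : ℝ

/-- `p` is a bounded variable exponent such that `1 / p` is locally log-Hölder continuous, with
bounds and log-Hölder constant controlled by `K`. Thus `p` belongs to the class of bounded
log-Hölder exponents on `X` if and only if this holds for some `K`. -/
structure IsLogExponent [MetricSpace X] [MeasurableSpace X] (μ : Measure X) (K : ExpBounds)
    (p : X → ℝ) : Prop where
  measurable : Measurable p
  pos : ∀ x, 0 < p x
  lower_pos : 0 < K.lower
  lower_le : ∀ᵐ x ∂μ, K.lower ≤ p x
  le_upper : ∀ᵐ x ∂μ, p x ≤ K.upper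
  logHolder : LogHolderWith K.logConst (fun x => 1 / p x)

/-- The semi-modular of the variable exponent Lebesgue space, for functions with values
in `[0,∞]` (a function `u` with values in `[-∞,∞]` is represented by `|u|`). -/
noncomputable def modular [MeasurableSpace X] (μ : Measure X) (p : X → ℝ) (f : X → ℝ≥0∞) :
    ℝ≥0∞ :=
  ∫⁻ x, f x ^ p x ∂μ

/-- The Luxemburg quasi-norm, with `inf ∅ = ∞`. -/
noncomputable def luxNorm [MeasurableSpace X] (μ : Measure X) (p : X → ℝ) (f : X → ℝ≥0∞) :
    ℝ≥0∞ :=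
  sInf {t : ℝ≥0∞ | 0 < t ∧ t < ∞ ∧ modular μ p (fun x => f x / t) ≤ 1}

/-- Membership of a non-negative function in the variable exponent Lebesgue space
(for a bounded exponent). -/
def MemVarLp [MeasurableSpace X] (μ : Measure X) (p : X → ℝ) (f : X → ℝ≥0∞) : Prop :=
  Measurable f ∧ modular μ p f < ∞

/-- The function `|u - c|` with values in `[0,∞]`. -/
noncomputable def absSub (u : X → EReal) (c : ℝ) : X → ℝ≥0∞ :=
  fun x => (u x - (c : EReal)).abs

/-- The scalar `s(·)`-gradients of `u`. -/
def ScalarGradients [MetricSpace X] [MeasurableSpace X] (μ : Measure X) (s : X → ℝ)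
    (u : X → EReal) : Set (X → ℝ≥0∞) :=
  {g | ∃ N : Set X, μ N = 0 ∧ ∀ x ∉ N, ∀ y ∉ N,
    (u x - u y).abs ≤
      ENNReal.ofReal (dist x y ^ s x) * g x + ENNReal.ofReal (dist x y ^ s y) * g y}

/-- The homogeneous Hajłasz-Sobolev functional: infimum of the norms of all
scalar gradients in the Lebesgue space, with `inf ∅ = ∞`. -/
noncomputable def homNorm [MetricSpace X] [MeasurableSpace X] (μ : Measure X) (s p : X → ℝ)
    (u : X → EReal) : ℝ≥0∞ :=
  ⨅ g ∈ {g : X → ℝ≥0∞ | g ∈ ScalarGradients μ s u ∧ MemVarLp μ p g}, luxNorm μ p g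

/-- The homogeneous Hajłasz-Sobolev space. -/
def HomSobolev [MetricSpace X] [MeasurableSpace X] (μ : Measure X) (s p : X → ℝ) :
    Set (X → EReal) :=
  {u | Measurable u ∧ (∀ᵐ x ∂μ, u x ≠ ⊤ ∧ u x ≠ ⊥) ∧ homNorm μ s p u < ∞}

/-- The inhomogeneous Hajłasz-Sobolev space. -/
def Sobolev [MetricSpace X] [MeasurableSpace X] (μ : Measure X) (s p : X → ℝ) :
    Set (X → EReal) :=
  {u | u ∈ HomSobolev μ s p ∧ MemVarLp μ p (fun x => (u x).abs)}

/-- The integral average of an almost everywhere finite function over the whole space. -/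
noncomputable def mean [MeasurableSpace X] (μ : Measure X) (u : X → EReal) : ℝ :=
  ⨍ x, (u x).toReal ∂μ

/-- A bounded metric measure space of diameter `D` satisfying the lower bound
`μ (B(x,r)) ≥ b * r ^ Q(x)` for `0 < r ≤ δ`, with bounded log-Hölder exponents `Q`, `p`, `s`
controlled by `KQ`, `Kp`, `Ks`. -/
structure Setting [MetricSpace X] [MeasurableSpace X] (μ : Measure X) (Q p s : X → ℝ)
    (b δ D : ℝ) (KQ Kp Ks : ExpBounds) : Prop where
  metricMeasure : IsMetricMeasure μ
  bounded : Bornology.IsBounded (univ : Set X)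
  diam_eq : Metric.diam (univ : Set X) = D
  lowerRegular : LowerRegular μ Q b δ
  expQ : IsLogExponent μ KQ Q
  expP : IsLogExponent μ Kp p
  expS : IsLogExponent μ Ks s

end VarExp

namespace VarExp

variable {X : Type*}

/-! All three inequalities come from one chaining argument along the dyadic level sets of the
gradient. Divide `u` and `g` by a scale `t` so that `w = g / t` has modular at most one. Chebyshev
bounds the measure of `{w ^ p > 2 ^ j}` by `2 ^ (-j)`, whereas a ball of radius `r` about `z` with
`r ^ Q z` a large multiple of `2 ^ (-j)` has larger measure. Hence, within distance of order `2 ^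
(-j / Q)` of any point there is a point with `w ^ p ≤ 2 ^ j` (`exists_not_mem_of_measure_le`).

Starting at `x` with `w x ^ p x ≤ 2 ^ k`, such points form a chain descending through the levels
(`exists_chain`). By the gradient inequality its step at level `i` changes `v = u / t` by at most a
multiple of `2 ^ (i * θ)`, where `θ = 1 / p - s / Q`. Log-Hölder continuity allows `θ` to be
evaluated at `x` throughout: the level `i` point is exponentially close to `x`, so exponents vary
there by `O(1 / i)`, which costs a bounded factor.

The sign of `θ` decides the rest. If `θ = 1 / γ > 0`, the sum is comparable to its top term, of
order `(1 + w ^ p) ^ (1 / γ)`, whose `γ`-th power is integrable. If `θ = 0`, the sum counts steps,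
about `log (1 + w ^ p)`, and its exponential is integrable. If `θ < 0`, the sum is comparable to its
lowest term. Stopping at the level `j` with `2 ^ (-j / Q x)` comparable to `d(x, y)` gives `2 ^ (j *
θ)`, of order `d(x, y) ^ α`, because `α = -Q θ`. Taking the infimum over `t` restores the Luxemburg
norm. -/

/-- The numerical data `K` is consistent. -/
structure ExpBounds.Admissible (K : ExpBounds) : Prop where
  lower_pos : 0 < K.lower
  lower_le_upper : K.lower ≤ K.upper
  logConst_pos : 0 < K.logConst

lemma ExpBounds.Admissible.upper_pos {K : ExpBounds} (hK : K.Admissible) : 0 < K.upper :=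
  hK.lower_pos.trans_le hK.lower_le_upper

/-- An exponent whose bounds hold everywhere. -/
structure IsUniformExponent [MetricSpace X] (K : ExpBounds) (p : X → ℝ) : Prop where
  lower_pos : 0 < K.lower
  lower_le : ∀ x, K.lower ≤ p x
  le_upper : ∀ x, p x ≤ K.upper
  logHolder : LogHolderWith K.logConst (fun x => 1 / p x)

/-! ### Log-Hölder exponents and their variation at small scales -/

section LogHolder

variable [MetricSpace X]

lemma one_le_log_exp_add (x y : X) : 1 ≤ Real.log (Real.exp 1 + 1 / dist x y) := by
  rw [Real.le_log_iff_exp_le (by positivity)]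
  have : 0 ≤ 1 / dist x y := by positivity
  linarith

lemma log_inv_dist_le {x y : X} (h : x ≠ y) :
    -Real.log (dist x y) ≤ Real.log (Real.exp 1 + 1 / dist x y) := by
  have hd : 0 < dist x y := dist_pos.2 h
  rw [← Real.log_inv]
  apply Real.log_le_log (by positivity)
  rw [one_div]
  linarith [Real.exp_pos 1]

/-- A log-Hölder function varies by `O(1 / j)` at distances `O(2 ^ (-j τ))`. -/
lemma LogHolderWith.nat_mul_abs_sub_le {L B τ : ℝ} {f : X → ℝ} (hf : LogHolderWith L f)
    (hB : 0 < B) (hτ : 0 < τ) {j : ℕ} {x y : X} (h : dist x y ≤ B * (2 : ℝ) ^ (-(j * τ))) :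
    j * |f x - f y| ≤ L * ((1 + |Real.log B|) / (τ * Real.log 2)) := by
  have hL := hf.1
  have hlog2 : 0 < Real.log 2 := Real.log_pos (by norm_num)
  rcases eq_or_ne x y with rfl | hxy
  · simp only [sub_self, abs_zero, mul_zero]
    positivity
  have h1 := one_le_log_exp_add x y
  have h2 := log_inv_dist_le hxy
  have h3 : Real.log (dist x y) ≤ Real.log B - j * τ * Real.log 2 := by
    have := Real.log_le_log (dist_pos.2 hxy) h
    rw [Real.log_mul hB.ne' (by positivity), Real.log_rpow (by norm_num)] at this
    linarith
  have h4 := hf.2 x y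
  set l := Real.log (Real.exp 1 + 1 / dist x y) with hl
  have h5 : j * τ * Real.log 2 ≤ l * (1 + |Real.log B|) := by
    nlinarith [le_abs_self (Real.log B), abs_nonneg (Real.log B)]
  have h6 : (j : ℝ) ≤ l * ((1 + |Real.log B|) / (τ * Real.log 2)) := by
    rw [← mul_div_assoc, le_div_iff₀ (by positivity)]
    linarith
  calc (j : ℝ) * |f x - f y| ≤ (l * ((1 + |Real.log B|) / (τ * Real.log 2))) * (L / l) := by
        gcongr
    _ = L * ((1 + |Real.log B|) / (τ * Real.log 2)) := by
        field_simp

/-- The modulus `L / log (e + 1 / d)` tends to zero with `d`; explicitly, `d < exp (-L / ε)` makes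
it smaller than `ε`. -/
lemma LogHolderWith.continuous {L : ℝ} {f : X → ℝ} (hf : LogHolderWith L f) : Continuous f := by
  rw [continuous_iff_continuousAt]
  intro x
  rw [ContinuousAt, tendsto_iff_dist_tendsto_zero]
  rw [Metric.tendsto_nhds]
  intro ε hε
  have hL := hf.1
  filter_upwards [Metric.ball_mem_nhds x (Real.exp_pos (-(L / ε)))] with y hy
  rw [Real.dist_0_eq_abs, abs_of_nonneg dist_nonneg, Real.dist_eq]
  rcases eq_or_ne y x with rfl | hyx
  · simpa using hε
  have h2 := log_inv_dist_le hyx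
  have h3 : Real.log (dist y x) < -(L / ε) := by
    rw [Real.log_lt_iff_lt_exp (dist_pos.2 hyx)]
    exact hy
  have h4 : L / ε < Real.log (Real.exp 1 + 1 / dist y x) := by linarith
  refine (hf.2 y x).trans_lt ?_
  rw [div_lt_iff₀ (by linarith [one_le_log_exp_add y x])]
  rw [div_lt_iff₀ hε] at h4
  linarith

end LogHolder

section Uniform

variable [MetricSpace X] {K : ExpBounds} {p : X → ℝ}

lemma IsUniformExponent.pos (hp : IsUniformExponent K p) (x : X) : 0 < p x :=
  hp.lower_pos.trans_le (hp.lower_le x)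

lemma IsUniformExponent.continuous (hp : IsUniformExponent K p) : Continuous p := by
  have h : p = fun x => (1 / p x)⁻¹ := by
    ext x
    simp
  rw [h]
  exact hp.logHolder.continuous.inv₀ fun x => (one_div_pos.2 (hp.pos x)).ne'

lemma IsUniformExponent.one_div_le (hp : IsUniformExponent K p) (x : X) :
    1 / p x ≤ 1 / K.lower :=
  one_div_le_one_div_of_le hp.lower_pos (hp.lower_le x)

lemma IsUniformExponent.le_one_div (hp : IsUniformExponent K p) (x : X) :
    1 / K.upper ≤ 1 / p x :=
  one_div_le_one_div_of_le (hp.pos x) (hp.le_upper x)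

end Uniform

/-- At scale `2 ^ (-j τ)` an exponent and its reciprocal are constant up to `O(1 / j)`. -/
lemma ExpBounds.exists_scale_const (K : ExpBounds) {B τ : ℝ} (hB : 0 < B) (hτ : 0 < τ) :
    ∃ M : ℝ, 0 ≤ M ∧ ∀ (X : Type v) [MetricSpace X] (p : X → ℝ), IsUniformExponent K p →
      ∀ (j : ℕ) (x y : X), dist x y ≤ B * (2 : ℝ) ^ (-(j * τ)) →
        j * |1 / p x - 1 / p y| ≤ M ∧ j * |p x - p y| ≤ M := by
  set M₀ := K.logConst * ((1 + |Real.log B|) / (τ * Real.log 2))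
  refine ⟨max (max M₀ (K.upper ^ 2 * M₀)) 0, le_max_right _ _, fun X _ p hp j x y h => ?_⟩
  have h1 : j * |1 / p x - 1 / p y| ≤ M₀ := hp.logHolder.nat_mul_abs_sub_le hB hτ h
  refine ⟨h1.trans ((le_max_left _ _).trans (le_max_left _ _)),
    le_trans ?_ ((le_max_right _ _).trans (le_max_left _ _))⟩
  have hx := hp.pos x
  have hy := hp.pos y
  have h2 : |p x - p y| = p x * p y * |1 / p x - 1 / p y| := by
    rw [← abs_of_pos (mul_pos hx hy), ← abs_mul, abs_sub_comm]
    congr 1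
    field_simp
  have h3 : p x * p y ≤ K.upper ^ 2 := by
    rw [sq]
    exact mul_le_mul (hp.le_upper x) (hp.le_upper y) hy.le (hx.le.trans (hp.le_upper x))
  calc j * |p x - p y| = (p x * p y) * (j * |1 / p x - 1 / p y|) := by rw [h2]; ring
    _ ≤ K.upper ^ 2 * M₀ := by gcongr

/-- Moving an exponent to a nearby point at scale `j` costs only the factor `2 ^ M`. -/
lemma rpow_two_le_of_mul_abs_sub_le {M a a' : ℝ} {j : ℕ} (h : j * |a - a'| ≤ M) :
    (2 : ℝ) ^ (-(j * a')) ≤ 2 ^ M * 2 ^ (-(j * a)) := by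
  rw [← Real.rpow_add (by norm_num)]
  apply Real.rpow_le_rpow_of_exponent_le (by norm_num)
  have : (j : ℝ) * (a - a') ≤ j * |a - a'| := by gcongr; exact le_abs_self _
  linarith

/-- Comparison of scaled quantities with slowly varying exponents `s`, `π` frozen. -/
lemma rpow_mul_rpow_two_le {M C S a a₁ s s' π π' d : ℝ} {j : ℕ} (hM : 0 ≤ M) (hC : 1 ≤ C)
    (ha : 0 ≤ a) (ha₁ : a ≤ a₁) (hs' : 0 ≤ s') (hS : s' ≤ S) (hs : j * |s - s'| ≤ M)
    (hπ : j * |π - π'| ≤ M) (hd : 0 ≤ d) (hdC : d ≤ C * 2 ^ (-(j * a))) :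
    d ^ s' * 2 ^ (j * π') ≤ C ^ S * 2 ^ (M * a₁ + M) * 2 ^ (j * (π - s * a)) := by
  have h2 : (0 : ℝ) < 2 := by norm_num
  have h1 : d ^ s' ≤ C ^ S * 2 ^ (-(j * a) * s') := by
    calc d ^ s' ≤ (C * 2 ^ (-(j * a))) ^ s' := Real.rpow_le_rpow hd hdC hs'
      _ = C ^ s' * 2 ^ (-(j * a) * s') := by
        rw [Real.mul_rpow (by linarith) (by positivity), ← Real.rpow_mul h2.le]
      _ ≤ C ^ S * 2 ^ (-(j * a) * s') := by
        gcongr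
  calc d ^ s' * 2 ^ (j * π') ≤ (C ^ S * 2 ^ (-(j * a) * s')) * 2 ^ (j * π') := by gcongr
    _ = C ^ S * 2 ^ (-(j * a) * s' + j * π') := by
      rw [mul_assoc, ← Real.rpow_add h2]
    _ ≤ C ^ S * 2 ^ ((M * a₁ + M) + j * (π - s * a)) := by
      refine mul_le_mul_of_nonneg_left (Real.rpow_le_rpow_of_exponent_le (by norm_num) ?_)
        (by positivity)
      · have e1 : (j : ℝ) * (s - s') ≤ M := le_trans (by gcongr; exact le_abs_self _) hs
        have e2 : (j : ℝ) * (π' - π) ≤ M := by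
          refine le_trans ?_ hπ
          rw [abs_sub_comm]
          gcongr; exact le_abs_self _
        have e3 : a * (j * (s - s')) ≤ M * a₁ := by
          calc a * (j * (s - s')) ≤ a * M := by gcongr
            _ ≤ M * a₁ := by rw [mul_comm]; gcongr
        linarith
    _ = _ := by rw [Real.rpow_add h2, mul_assoc]

/-! ### From almost everywhere bounds to pointwise bounds -/

section Support

variable [MetricSpace X] [MeasurableSpace X] {μ : Measure X}

lemma IsMetricMeasure.isOpenPosMeasure (hμ : IsMetricMeasure μ) : μ.IsOpenPosMeasure where
  open_pos U hU := by
    rintro ⟨x, hx⟩ h0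
    obtain ⟨r, hr, hrU⟩ := Metric.isOpen_iff.1 hU x hx
    exact (hμ x r hr).1.ne' (measure_mono_null hrU h0)

/-- A set of full measure is dense when open sets have positive measure, and `{f ≤ g}` is closed. -/
lemma forall_le_of_ae_le [μ.IsOpenPosMeasure] {f g : X → ℝ} (hf : Continuous f)
    (hg : Continuous g) (h : ∀ᵐ x ∂μ, f x ≤ g x) (x : X) : f x ≤ g x := by
  have hsub := (isClosed_le hf hg).closure_subset_iff.2 (subset_refl {x | f x ≤ g x})
  rw [(Measure.dense_of_ae h).closure_eq] at hsub
  exact hsub (mem_univ x)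

lemma IsLogExponent.isUniformExponent {K : ExpBounds} {p : X → ℝ} [μ.IsOpenPosMeasure]
    (hp : IsLogExponent μ K p) : IsUniformExponent K p := by
  have hc : Continuous p := by
    have h : p = fun x => (1 / p x)⁻¹ := by
      ext x
      simp
    rw [h]
    exact hp.logHolder.continuous.inv₀ fun x => (one_div_pos.2 (hp.pos x)).ne'
  exact ⟨hp.lower_pos, forall_le_of_ae_le continuous_const hc hp.lower_le,
    forall_le_of_ae_le hc continuous_const hp.le_upper, hp.logHolder⟩

end Support

/-! ### Chains through the level sets of the gradient -/

/-- A real function `v` with a gradient `w` of modular at most one, both with respect to an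
exceptional null set `N`. The bound on the modular enters through the level sets of `w ^ p`. -/
structure NormalizedPair [MetricSpace X] [MeasurableSpace X] (μ : Measure X) (Q p s : X → ℝ)
    (b δ : ℝ) (KQ Kp Ks : ExpBounds) (v w : X → ℝ) (N : Set X) : Prop where
  expQ : IsUniformExponent KQ Q
  expP : IsUniformExponent Kp p
  expS : IsUniformExponent Ks s
  lowerRegular : LowerRegular μ Q b δ
  null : μ N = 0
  nonneg : ∀ x, 0 ≤ w x
  gradient : ∀ x ∉ N, ∀ y ∉ N, |v x - v y| ≤ dist x y ^ s x * w x + dist x y ^ s y * w y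
  level : ∀ j : ℕ, μ {x | (2 : ℝ) ^ j < w x ^ p x} ≤ ENNReal.ofReal (2 ^ (-(j : ℝ)))

/-- Sets of measure at most `2 * 2 ^ (-j)` do not contain balls of radius
comparable to `2 ^ (-j / Q)`. -/
lemma exists_not_mem_of_measure_le {b δ : ℝ} (hb : 0 < b) (hb1 : b ≤ 1) (hδ : 0 < δ)
    {KQ : ExpBounds} (hQ : KQ.Admissible) :
    ∃ j₀ : ℕ, ∃ A : ℝ, 1 ≤ A ∧ ∀ (X : Type v) [MetricSpace X] [MeasurableSpace X]
      (μ : Measure X) (Q : X → ℝ), IsUniformExponent KQ Q → LowerRegular μ Q b δ →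
      ∀ j ≥ j₀, ∀ (z : X) (F : Set X), μ F ≤ ENNReal.ofReal (2 * 2 ^ (-(j : ℝ))) →
        ∃ y ∉ F, dist z y ≤ A * 2 ^ (-(j * (1 / Q z))) := by
  have hm : 0 < min 1 δ := lt_min one_pos hδ
  -- The base `min 1 δ` is at most one, so the upper bound of `Q` is the worst exponent, and one
  -- `j₀` keeps all radii below `δ`.
  obtain ⟨j₀, hj₀⟩ := exists_pow_lt_of_lt_one
    (show 0 < (min 1 δ) ^ KQ.upper / (3 / b) by positivity) (show (1 / 2 : ℝ) < 1 by norm_num)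
  have hA₀ : 1 ≤ 3 / b := by
    rw [le_div_iff₀ hb]
    linarith
  refine ⟨j₀, (3 / b) ^ (1 / KQ.lower), Real.one_le_rpow hA₀ (one_div_pos.2 hQ.lower_pos).le, ?_⟩
  intro X _ _ μ Q hQu hreg j hj z F hF
  have hQz := hQu.pos z
  have h2j : (2 : ℝ) ^ (-(j : ℝ)) = (1 / 2) ^ j := by
    rw [Real.rpow_neg (by norm_num), Real.rpow_natCast, one_div, inv_pow]
  have hsmall : 3 / b * 2 ^ (-(j : ℝ)) ≤ (min 1 δ) ^ Q z := by
    have h1 : (2 : ℝ) ^ (-(j : ℝ)) ≤ (min 1 δ) ^ KQ.upper / (3 / b) := by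
      rw [h2j]
      exact (pow_le_pow_of_le_one (by norm_num) (by norm_num) hj).trans hj₀.le
    rw [le_div_iff₀ (by positivity), mul_comm] at h1
    exact h1.trans (Real.rpow_le_rpow_of_exponent_ge hm (min_le_left _ _) (hQu.le_upper z))
  -- With this radius the ball has measure at least `3 * 2 ^ (-j)`, which exceeds the measure `2 * 2
  -- ^ (-j)` allowed to `F`.
  set r := (3 / b * 2 ^ (-(j : ℝ))) ^ (1 / Q z) with hr
  have hr0 : 0 < r := by positivity
  have hrδ : r ≤ δ := by
    calc r ≤ ((min 1 δ) ^ Q z) ^ (1 / Q z) := by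
          apply Real.rpow_le_rpow (by positivity) hsmall (one_div_pos.2 hQz).le
      _ = min 1 δ := by rw [← Real.rpow_mul hm.le, mul_one_div_cancel hQz.ne', Real.rpow_one]
      _ ≤ δ := min_le_right _ _
  have hball := hreg z r hr0 hrδ
  have hbr : b * r ^ Q z = 3 * 2 ^ (-(j : ℝ)) := by
    rw [hr, ← Real.rpow_mul (by positivity), one_div_mul_cancel hQz.ne', Real.rpow_one]
    field_simp
  have hnot : ¬ Metric.ball z r ⊆ F := by
    intro hsub
    have h1 := (hball.trans (measure_mono hsub)).trans hF
    rw [hbr, ENNReal.ofReal_le_ofReal_iff (by positivity)] at h1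
    have : (0 : ℝ) < 2 ^ (-(j : ℝ)) := by positivity
    linarith
  obtain ⟨y, hy, hyF⟩ := not_subset.1 hnot
  refine ⟨y, hyF, ?_⟩
  rw [Metric.mem_ball, dist_comm] at hy
  refine hy.le.trans ?_
  rw [hr, Real.mul_rpow (by positivity) (by positivity), ← Real.rpow_mul (by norm_num), neg_mul]
  exact mul_le_mul_of_nonneg_right
    (Real.rpow_le_rpow_of_exponent_le hA₀ (hQu.one_div_le z)) (by positivity)

lemma rpow_two_neg_lt_one {τ : ℝ} (hτ : 0 < τ) : (2 : ℝ) ^ (-τ) < 1 :=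
  Real.rpow_lt_one_of_one_lt_of_neg (by norm_num) (by linarith)

/-- Adding one step of size `2 ^ (-j a)` to a geometric chain bound. -/
lemma geometric_step {C a τ : ℝ} {j : ℕ} (hC : 0 ≤ C) (hτ : 0 < τ) (ha : τ ≤ a) :
    C * (1 - 2 ^ (-τ))⁻¹ * (2 : ℝ) ^ (-((j + 1 : ℕ) * a)) + C * 2 ^ (-(j * a)) ≤
      C * (1 - 2 ^ (-τ))⁻¹ * 2 ^ (-(j * a)) := by
  have h1 := rpow_two_neg_lt_one hτ
  have h2 : (2 : ℝ) ^ (-((j + 1 : ℕ) * a)) = 2 ^ (-(j * a)) * 2 ^ (-a) := by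
    rw [← Real.rpow_add (by norm_num)]
    push_cast
    ring_nf
  have h3 : (2 : ℝ) ^ (-a) ≤ 2 ^ (-τ) :=
    Real.rpow_le_rpow_of_exponent_le (by norm_num) (by linarith)
  have h4 : (1 - (2 : ℝ) ^ (-τ))⁻¹ * 2 ^ (-τ) + 1 = (1 - 2 ^ (-τ))⁻¹ := by
    have : 1 - (2 : ℝ) ^ (-τ) ≠ 0 := by linarith
    field_simp
    ring
  have h5 : 0 < (1 - (2 : ℝ) ^ (-τ))⁻¹ := inv_pos.2 (by linarith)
  rw [h2]
  calc C * (1 - 2 ^ (-τ))⁻¹ * ((2 : ℝ) ^ (-(j * a)) * 2 ^ (-a)) + C * 2 ^ (-(j * a))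
      ≤ C * (1 - 2 ^ (-τ))⁻¹ * ((2 : ℝ) ^ (-(j * a)) * 2 ^ (-τ)) + C * 2 ^ (-(j * a)) := by
        gcongr
    _ = C * ((1 - (2 : ℝ) ^ (-τ))⁻¹ * 2 ^ (-τ) + 1) * 2 ^ (-(j * a)) := by ring
    _ = _ := by rw [h4]

lemma le_rpow_div_of_rpow_le {h p : ℝ} {j : ℕ} (hh : 0 ≤ h) (hp : 0 < p) (hj : h ^ p ≤ 2 ^ j) :
    h ≤ (2 : ℝ) ^ (j * (1 / p)) := by
  calc h = (h ^ p) ^ (1 / p) := by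
        rw [← Real.rpow_mul hh, mul_one_div_cancel hp.ne', Real.rpow_one]
    _ ≤ ((2 : ℝ) ^ j) ^ (1 / p) :=
        Real.rpow_le_rpow (by positivity) hj (one_div_pos.2 hp).le
    _ = _ := by rw [← Real.rpow_natCast, ← Real.rpow_mul (by norm_num)]

/-- Points of the level set of height `2 ^ k` are joined to the level set of height `2 ^ j`,
with control of the distance and of the oscillation. -/
theorem exists_chain {b δ : ℝ} (hb : 0 < b) (hb1 : b ≤ 1) (hδ : 0 < δ) {KQ Kp Ks : ExpBounds}
    (hQ : KQ.Admissible) :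
    ∃ j₀ : ℕ, ∃ B C₁ C : ℝ, 0 < B ∧ 0 < C₁ ∧ 0 < C ∧
      ∀ (X : Type v) [MetricSpace X] [MeasurableSpace X] (μ : Measure X) (Q p s : X → ℝ)
        (v w : X → ℝ) (N : Set X), NormalizedPair μ Q p s b δ KQ Kp Ks v w N →
      (∀ F : Set X, [Nonempty X] → μ F ≤ ENNReal.ofReal (2 * 2 ^ (-(j₀ : ℝ))) → ∃ y, y ∉ F) ∧
      ∀ x ∉ N, ∀ k : ℕ, w x ^ p x ≤ 2 ^ k → ∀ j, j₀ ≤ j → j ≤ k →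
        ∃ y ∉ N, w y ^ p y ≤ 2 ^ j ∧ dist x y ≤ B * 2 ^ (-(j * (1 / KQ.upper))) ∧
          dist x y ≤ C₁ * 2 ^ (-(j * (1 / Q x))) ∧
          |v x - v y| ≤ C * ∑ i ∈ Finset.Ico j k, (2 : ℝ) ^ (i * (1 / p x - s x * (1 / Q x))) := by
  obtain ⟨j₀, A, hA, hsel⟩ := exists_not_mem_of_measure_le.{v} hb hb1 hδ hQ
  -- A cruder distance bound with the uniform rate `τ ≤ 1 / Q` is carried along the chain. It keeps
  -- all points close enough to `x` to freeze the exponents, which then yields the sharp rate `1 / Q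
  -- x`.
  set τ := 1 / KQ.upper with hτdef
  have hτ : 0 < τ := one_div_pos.2 hQ.upper_pos
  set G := (1 - (2 : ℝ) ^ (-τ))⁻¹ with hG
  have hGpos : 0 < G := inv_pos.2 (by linarith [rpow_two_neg_lt_one hτ])
  have hB : 0 < A * G := by positivity
  obtain ⟨MQ, hMQ0, hMQ⟩ := KQ.exists_scale_const.{v} hB hτ
  obtain ⟨MP, hMP0, hMP⟩ := Kp.exists_scale_const.{v} hB hτ
  obtain ⟨MS, hMS0, hMS⟩ := Ks.exists_scale_const.{v} hB hτ
  set M := max MP MS with hM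
  have hM0 : 0 ≤ M := hMP0.trans (le_max_left _ _)
  set A' := A * 2 ^ MQ with hA'
  have hA'1 : 1 ≤ A' := one_le_mul_of_one_le_of_one_le hA (Real.one_le_rpow (by norm_num) hMQ0)
  set C := A' ^ Ks.upper * 2 ^ (M * (1 / KQ.lower) + M) with hC
  have hCpos : 0 < C := by positivity
  refine ⟨j₀, A * G, A' * G, 2 ^ (1 / Kp.lower) * C + C, hB, by positivity, by positivity, ?_⟩
  intro X _ _ μ Q p s v w N H
  refine ⟨fun F hne hF => ?_, fun x hxN k hxk j hj hjk => ?_⟩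
  · obtain ⟨y, hy, -⟩ := hsel X μ Q H.expQ H.lowerRegular j₀ le_rfl hne.some F hF
    exact ⟨y, hy⟩
  -- The chain starts with `x` itself at level `k`; each step replaces a point `y` of level `j + 1`
  -- by a nearby `z` of level `j`.
  induction hjk using Nat.decreasingInduction with
  | self => exact ⟨x, hxN, hxk, by simp; positivity, by simp; positivity, by simp⟩
  | of_succ j hjk ih =>
    obtain ⟨y, hyN, hyj, hyB, hyC, hyv⟩ := ih (by omega)
    have hF : μ (N ∪ {x | (2 : ℝ) ^ j < w x ^ p x}) ≤ ENNReal.ofReal (2 * 2 ^ (-(j : ℝ))) := by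
      refine (measure_union_le _ _).trans ?_
      rw [H.null, zero_add]
      refine (H.level j).trans (ENNReal.ofReal_le_ofReal ?_)
      have : (0 : ℝ) < 2 ^ (-(j : ℝ)) := by positivity
      linarith
    obtain ⟨z, hzF, hyz⟩ := hsel X μ Q H.expQ H.lowerRegular j hj y _ hF
    simp only [mem_union, mem_ofPred_eq, not_or, not_lt] at hzF
    obtain ⟨hzN, hzj⟩ := hzF
    have hτQ : ∀ t, τ ≤ 1 / Q t := H.expQ.le_one_div
    have hyzτ : dist y z ≤ A * 2 ^ (-(j * τ)) := by
      refine hyz.trans ?_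
      have := hτQ y
      gcongr
      norm_num
    have hyB' : dist x y ≤ A * G * 2 ^ (-(j * τ)) := by
      refine hyB.trans ?_
      gcongr
      · norm_num
      · omega
    have hzB : dist x z ≤ A * G * 2 ^ (-(j * τ)) :=
      (dist_triangle x y z).trans ((add_le_add hyB hyzτ).trans
        (geometric_step (by linarith) hτ le_rfl))
    have hyzx : dist y z ≤ A' * 2 ^ (-(j * (1 / Q x))) := by
      refine hyz.trans ?_
      rw [hA', mul_assoc]
      exact mul_le_mul_of_nonneg_left
        (rpow_two_le_of_mul_abs_sub_le (hMQ X Q H.expQ j x y hyB').1) (by linarith)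
    have hzC : dist x z ≤ A' * G * 2 ^ (-(j * (1 / Q x))) :=
      (dist_triangle x y z).trans ((add_le_add hyC hyzx).trans
        (geometric_step (by linarith) hτ (hτQ x)))
    have key : ∀ t, dist x t ≤ A * G * 2 ^ (-(j * τ)) →
        dist y z ^ s t * 2 ^ (j * (1 / p t)) ≤ C * 2 ^ (j * (1 / p x - s x * (1 / Q x))) := by
      intro t ht
      exact rpow_mul_rpow_two_le hM0 hA'1 (hτ.le.trans (hτQ x)) (H.expQ.one_div_le x)
        (H.expS.pos t).le (H.expS.le_upper t)
        ((hMS X s H.expS j x t ht).2.trans (le_max_right _ _))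
        ((hMP X p H.expP j x t ht).1.trans (le_max_left _ _)) dist_nonneg hyzx
    -- Only level `j + 1` is known for `y`, hence the extra factor, at most `2 ^ (1 / Kp.lower)`.
    have hwy : w y ≤ 2 ^ (1 / Kp.lower) * 2 ^ (j * (1 / p y)) := by
      refine (le_rpow_div_of_rpow_le (H.nonneg y) (H.expP.pos y) hyj).trans ?_
      rw [← Real.rpow_add (by norm_num)]
      apply Real.rpow_le_rpow_of_exponent_le (by norm_num)
      have := H.expP.one_div_le y
      push_cast
      linarith
    have hwz : w z ≤ 2 ^ (j * (1 / p z)) :=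
      le_rpow_div_of_rpow_le (H.nonneg z) (H.expP.pos z) hzj
    refine ⟨z, hzN, hzj, hzB, hzC, ?_⟩
    have hstep : |v y - v z| ≤
        (2 ^ (1 / Kp.lower) * C + C) * 2 ^ (j * (1 / p x - s x * (1 / Q x))) := by
      calc |v y - v z| ≤ dist y z ^ s y * w y + dist y z ^ s z * w z := H.gradient y hyN z hzN
        _ ≤ dist y z ^ s y * (2 ^ (1 / Kp.lower) * 2 ^ (j * (1 / p y))) +
            dist y z ^ s z * 2 ^ (j * (1 / p z)) := by gcongr
        _ = 2 ^ (1 / Kp.lower) * (dist y z ^ s y * 2 ^ (j * (1 / p y))) +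
            dist y z ^ s z * 2 ^ (j * (1 / p z)) := by ring
        _ ≤ 2 ^ (1 / Kp.lower) * (C * 2 ^ (j * (1 / p x - s x * (1 / Q x)))) +
            C * 2 ^ (j * (1 / p x - s x * (1 / Q x))) :=
          add_le_add (mul_le_mul_of_nonneg_left (key y hyB') (by positivity)) (key z hzB)
        _ = _ := by ring
    rw [Finset.sum_eq_sum_Ico_succ_bot hjk, mul_add]
    calc |v x - v z| ≤ |v x - v y| + |v y - v z| := abs_sub_le _ _ _
      _ ≤ _ := by rw [add_comm]; exact add_le_add hstep hyv

/-! ### Summing the chain in the three regimes -/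

lemma exists_dyadic_near {h : ℝ} (hh : 0 ≤ h) :
    ∃ n : ℕ, 1 + h ≤ 2 ^ n ∧ (2 : ℝ) ^ n ≤ 2 * (1 + h) := by
  obtain ⟨n, h1, h2⟩ := exists_nat_pow_near (show 1 ≤ 1 + h by linarith) one_lt_two
  refine ⟨n + 1, h2.le, ?_⟩
  rw [pow_succ]
  linarith

/-- A growing geometric sum is controlled by its upper end; the constant involves only the lower
bound `θ₀`, so it is uniform in the point. -/
lemma sum_rpow_two_le_of_pos {θ₀ θ : ℝ} (hθ₀ : 0 < θ₀) (hθ : θ₀ ≤ θ) (j n : ℕ) :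
    ∑ i ∈ Finset.Ico j (j + n), (2 : ℝ) ^ (i * θ) ≤
      ((2 : ℝ) ^ θ₀ - 1)⁻¹ * 2 ^ ((j + n : ℕ) * θ) := by
  have h1 : 1 < (2 : ℝ) ^ θ₀ := Real.one_lt_rpow (by norm_num) hθ₀
  have hG : 0 < ((2 : ℝ) ^ θ₀ - 1)⁻¹ := inv_pos.2 (by linarith)
  induction n with
  | zero => simp; positivity
  | succ n ih =>
    rw [← add_assoc, Finset.sum_Ico_succ_top (by omega)]
    have h2 : (2 : ℝ) ^ ((j + n + 1 : ℕ) * θ) = 2 ^ ((j + n : ℕ) * θ) * 2 ^ θ := by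
      rw [← Real.rpow_add (by norm_num)]
      push_cast
      ring_nf
    have h3 : (2 : ℝ) ^ θ₀ ≤ 2 ^ θ := Real.rpow_le_rpow_of_exponent_le (by norm_num) hθ
    have h4 : ((2 : ℝ) ^ θ₀ - 1)⁻¹ + 1 = ((2 : ℝ) ^ θ₀ - 1)⁻¹ * 2 ^ θ₀ := by
      have : (2 : ℝ) ^ θ₀ - 1 ≠ 0 := by linarith
      field_simp
      ring
    calc _ ≤ ((2 : ℝ) ^ θ₀ - 1)⁻¹ * 2 ^ ((j + n : ℕ) * θ) + 2 ^ ((j + n : ℕ) * θ) := by gcongr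
      _ = (((2 : ℝ) ^ θ₀ - 1)⁻¹ + 1) * 2 ^ ((j + n : ℕ) * θ) := by ring
      _ = ((2 : ℝ) ^ θ₀ - 1)⁻¹ * (2 ^ ((j + n : ℕ) * θ) * 2 ^ θ₀) := by rw [h4]; ring
      _ ≤ _ := by rw [h2]; gcongr

/-- Subcritical regime: choosing the top level with `2 ^ n` comparable to `1 + h` turns the top term
into a multiple of `(1 + h) ^ θ`. -/
lemma exists_sum_rpow_two_le_of_pos {θ₀ θ₁ θ h : ℝ} (hθ₀ : 0 < θ₀) (hθ : θ₀ ≤ θ) (hθ₁ : θ ≤ θ₁)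
    (hh : 0 ≤ h) (j : ℕ) :
    ∃ n : ℕ, h ≤ 2 ^ (j + n) ∧ 1 + ∑ i ∈ Finset.Ico j (j + n), (2 : ℝ) ^ (i * θ) ≤
      (1 + ((2 : ℝ) ^ θ₀ - 1)⁻¹ * (2 ^ (j * θ₁) * 2 ^ θ₁)) * (1 + h) ^ θ := by
  obtain ⟨n, h1, h2⟩ := exists_dyadic_near hh
  have hG : 0 < ((2 : ℝ) ^ θ₀ - 1)⁻¹ :=
    inv_pos.2 (by linarith [Real.one_lt_rpow (show (1 : ℝ) < 2 by norm_num) hθ₀])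
  refine ⟨n, ?_, ?_⟩
  · have : (2 : ℝ) ^ n ≤ 2 ^ (j + n) := pow_le_pow_right₀ (by norm_num) (by omega)
    linarith
  have h3 : (2 : ℝ) ^ (n * θ) ≤ 2 ^ θ₁ * (1 + h) ^ θ := by
    calc (2 : ℝ) ^ (n * θ) = ((2 : ℝ) ^ n) ^ θ := by
          rw [Real.rpow_mul (by norm_num), Real.rpow_natCast]
      _ ≤ (2 * (1 + h)) ^ θ := Real.rpow_le_rpow (by positivity) h2 (by linarith)
      _ = 2 ^ θ * (1 + h) ^ θ := Real.mul_rpow (by norm_num) (by linarith)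
      _ ≤ 2 ^ θ₁ * (1 + h) ^ θ := by
        gcongr
        norm_num
  have h4 : (2 : ℝ) ^ ((j + n : ℕ) * θ) ≤ 2 ^ (j * θ₁) * (2 ^ θ₁ * (1 + h) ^ θ) := by
    rw [Nat.cast_add, add_mul, Real.rpow_add (by norm_num)]
    gcongr
    norm_num
  have h5 : 1 ≤ (1 + h) ^ θ := Real.one_le_rpow (by linarith) (by linarith)
  calc _ ≤ (1 + h) ^ θ + ((2 : ℝ) ^ θ₀ - 1)⁻¹ * (2 ^ (j * θ₁) * (2 ^ θ₁ * (1 + h) ^ θ)) := by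
        gcongr
        exact (sum_rpow_two_le_of_pos hθ₀ hθ j n).trans (by gcongr)
    _ = _ := by ring

/-- Critical regime: all terms equal one, so only the number of steps matters. The factor 2 comes
from `log 2 > 1 / 2`. -/
lemma exists_card_le_log {h : ℝ} (hh : 0 ≤ h) (j : ℕ) :
    ∃ n : ℕ, h ≤ 2 ^ (j + n) ∧ (n : ℝ) ≤ 1 + 2 * Real.log (1 + h) := by
  obtain ⟨n, h1, h2⟩ := exists_dyadic_near hh
  refine ⟨n, ?_, ?_⟩
  · have : (2 : ℝ) ^ n ≤ 2 ^ (j + n) := pow_le_pow_right₀ (by norm_num) (by omega)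
    linarith
  have h3 := Real.log_le_log (by positivity) h2
  rw [Real.log_pow, Real.log_mul (by norm_num) (by linarith)] at h3
  have h4 := Real.log_two_gt_d9
  have h5 : 0 ≤ Real.log (1 + h) := Real.log_nonneg (by linarith)
  by_contra! h6
  nlinarith

/-- Supercritical regime: the bound does not involve the top level `k`, so the size of `w` at the
starting point drops out. -/
lemma sum_rpow_two_le_of_neg {η θ : ℝ} (hη : 0 < η) (hθ : θ ≤ -η) {j k : ℕ} (hjk : j ≤ k) :
    ∑ i ∈ Finset.Ico j k, (2 : ℝ) ^ (i * θ) ≤ (1 - 2 ^ (-η))⁻¹ * 2 ^ (j * θ) := by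
  have hG : 0 < (1 - (2 : ℝ) ^ (-η))⁻¹ := inv_pos.2 (by linarith [rpow_two_neg_lt_one hη])
  induction hjk using Nat.decreasingInduction with
  | self => simp; positivity
  | of_succ j hjk ih =>
    rw [Finset.sum_eq_sum_Ico_succ_bot hjk]
    have h := geometric_step (C := 1) (j := j) zero_le_one hη (show η ≤ -θ by linarith)
    simp only [one_mul, mul_neg, neg_neg] at h
    linarith

/-! ### Oscillation and Hölder bounds for normalized pairs -/

/-- Oscillation of a function from its values on the lowest level set of the gradient. -/
theorem exists_oscillation_bound {b δ D : ℝ} (hb : 0 < b) (hb1 : b ≤ 1) (hδ : 0 < δ)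
    {KQ Kp Ks : ExpBounds} (hQ : KQ.Admissible) :
    ∃ j₀ : ℕ, ∃ C : ℝ, 0 < C ∧
      ∀ (X : Type v) [MetricSpace X] [MeasurableSpace X] [Nonempty X] (μ : Measure X)
        (Q p s : X → ℝ) (v w : X → ℝ) (N : Set X), NormalizedPair μ Q p s b δ KQ Kp Ks v w N →
        (∀ x y : X, dist x y ≤ D) →
      ENNReal.ofReal (2 ^ (-(j₀ : ℝ))) ≤ μ univ ∧
      (∀ F : Set X, μ F ≤ ENNReal.ofReal (2 ^ (-(j₀ : ℝ))) → ∃ c ∉ N, w c ^ p c ≤ 2 ^ j₀ ∧ c ∉ F) ∧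
      ∀ c ∉ N, w c ^ p c ≤ 2 ^ j₀ → ∀ x ∉ N, ∀ n : ℕ, w x ^ p x ≤ 2 ^ (j₀ + n) →
        |v x - v c| ≤ C * (1 + ∑ i ∈ Finset.Ico j₀ (j₀ + n),
          (2 : ℝ) ^ (i * (1 / p x - s x * (1 / Q x)))) := by
  obtain ⟨j₀, B, C₁, C, hB, hC₁, hC, H⟩ := exists_chain.{v} (Kp := Kp) (Ks := Ks) hb hb1 hδ hQ
  -- Bounds the difference of `v` at two points of the lowest level set: there `w` is bounded, and
  -- distances are at most `D`.
  set E := 2 * ((max 1 D) ^ Ks.upper * 2 ^ (j₀ * (1 / Kp.lower))) with hE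
  have hm : 0 < max 1 D := lt_max_of_lt_left one_pos
  have hE0 : 0 < E := by positivity
  refine ⟨j₀, C + E, by positivity, ?_⟩
  intro X _ _ _ μ Q p s v w N HN hD
  obtain ⟨H1, H2⟩ := H X μ Q p s v w N HN
  have htwo : ENNReal.ofReal (2 * 2 ^ (-(j₀ : ℝ))) =
      ENNReal.ofReal (2 ^ (-(j₀ : ℝ))) + ENNReal.ofReal (2 ^ (-(j₀ : ℝ))) := by
    rw [← ENNReal.ofReal_add (by positivity) (by positivity)]
    ring_nf
  refine ⟨?_, fun F hF => ?_, fun c hc hwc x hx n hn => ?_⟩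
  -- If the whole space had smaller measure, it could itself be taken as the avoided set.
  · by_contra! hlt
    obtain ⟨y, hy⟩ := H1 univ (hlt.le.trans (by rw [htwo]; exact le_self_add))
    exact hy (mem_univ y)
  -- The factor 2 in the avoidable measure leaves room for `F` beside the exceptional level set.
  · obtain ⟨y, hy⟩ := H1 (N ∪ {x | (2 : ℝ) ^ j₀ < w x ^ p x} ∪ F) (by
      rw [htwo]
      refine (measure_union_le _ _).trans (add_le_add ((measure_union_le _ _).trans ?_) hF)
      rw [HN.null, zero_add]
      exact HN.level j₀)
    simp only [mem_union, mem_ofPred_eq, not_or, not_lt] at hy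
    exact ⟨y, hy.1.1, hy.1.2, hy.2⟩
  · obtain ⟨y, hyN, hyj, -, -, hv⟩ := H2 x hx (j₀ + n) hn j₀ le_rfl (by omega)
    have key : ∀ t, w t ^ p t ≤ 2 ^ j₀ →
        dist y c ^ s t * w t ≤ (max 1 D) ^ Ks.upper * 2 ^ (j₀ * (1 / Kp.lower)) := by
      intro t ht
      have hst := HN.expS.pos t
      have h1 : dist y c ^ s t ≤ (max 1 D) ^ Ks.upper :=
        (Real.rpow_le_rpow dist_nonneg ((hD y c).trans (le_max_right _ _)) hst.le).trans
          (Real.rpow_le_rpow_of_exponent_le (le_max_left _ _) (HN.expS.le_upper t))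
      have h2 : w t ≤ 2 ^ (j₀ * (1 / Kp.lower)) := by
        refine (le_rpow_div_of_rpow_le (HN.nonneg t) (HN.expP.pos t) ht).trans ?_
        apply Real.rpow_le_rpow_of_exponent_le (by norm_num)
        exact mul_le_mul_of_nonneg_left (HN.expP.one_div_le t) (Nat.cast_nonneg _)
      exact mul_le_mul h1 h2 (HN.nonneg t) (by positivity)
    have hyc : |v y - v c| ≤ E := by
      refine (HN.gradient y hyN c hc).trans ?_
      have := key y hyj
      have := key c hwc
      linarith
    set S := ∑ i ∈ Finset.Ico j₀ (j₀ + n), (2 : ℝ) ^ (i * (1 / p x - s x * (1 / Q x)))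
    have hS : 0 ≤ S := Finset.sum_nonneg fun i _ => by positivity
    calc |v x - v c| ≤ |v x - v y| + |v y - v c| := abs_sub_le _ _ _
      _ ≤ C * S + E := add_le_add hv hyc
      _ ≤ (C + E) * (1 + S) := by nlinarith

set_option maxHeartbeats 1000000 in
/-- Hölder estimate off the exceptional set in the supercritical case. -/
theorem exists_holder_bound {b δ D η : ℝ} (hb : 0 < b) (hb1 : b ≤ 1) (hδ : 0 < δ)
    {KQ Kp Ks : ExpBounds} (hQ : KQ.Admissible) (hη : 0 < η) :
    ∃ C : ℝ, 0 < C ∧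
      ∀ (X : Type v) [MetricSpace X] [MeasurableSpace X] (μ : Measure X)
        (Q p s : X → ℝ) (v w : X → ℝ) (N : Set X), NormalizedPair μ Q p s b δ KQ Kp Ks v w N →
        (∀ x y : X, dist x y ≤ D) → (∀ x, η ≤ s x * (1 / Q x) - 1 / p x) →
      ∀ x ∉ N, ∀ y ∉ N, |v x - v y| ≤ C * dist x y ^ (s x - Q x / p x) := by
  obtain ⟨j₁, C₂, hC₂, HO⟩ :=
    exists_oscillation_bound.{v} (D := D) (Kp := Kp) (Ks := Ks) hb hb1 hδ hQ
  obtain ⟨j₀, B, C₁, C, hB, hC₁, hC, H⟩ := exists_chain.{v} (Kp := Kp) (Ks := Ks) hb hb1 hδ hQ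
  set τ := 1 / KQ.upper with hτdef
  have hτ : 0 < τ := one_div_pos.2 hQ.upper_pos
  set G := (1 - (2 : ℝ) ^ (-η))⁻¹ with hG
  have hGpos : 0 < G := inv_pos.2 (by linarith [rpow_two_neg_lt_one hη])
  have hB' : 0 < 1 + B := by linarith
  obtain ⟨MQ, hMQ0, hMQ⟩ := KQ.exists_scale_const.{v} hB' hτ
  obtain ⟨MP, hMP0, hMP⟩ := Kp.exists_scale_const.{v} hB' hτ
  obtain ⟨MS, hMS0, hMS⟩ := Ks.exists_scale_const.{v} hB' hτ
  set M := max MP MS with hM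
  have hM0 : 0 ≤ M := hMP0.trans (le_max_left _ _)
  -- The first three terms bound `d(x', y')` along the path through `x` and `y`; the last makes `2 ^
  -- (-j / Q y)` an admissible length in `key`.
  set A := C₁ + 1 + C₁ * 2 ^ MQ + 2 ^ MQ with hA
  have h2MQ : 1 ≤ (2 : ℝ) ^ MQ := Real.one_le_rpow (by norm_num) hMQ0
  have hA1 : 1 ≤ A := by
    have : 0 ≤ C₁ * 2 ^ MQ := by positivity
    linarith
  set C₃ := A ^ Ks.upper * 2 ^ (M * (1 / KQ.lower) + M) with hC₃
  have hC₃0 : 0 < C₃ := by positivity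
  set W := (2 : ℝ) ^ (Ks.upper * (1 / KQ.lower)) with hW
  have hW0 : 0 < W := by positivity
  set V := ((2 : ℝ) ^ (j₀ * (Ks.upper * (1 / KQ.lower)))) with hV
  set C₄ := 2 * (C₂ * (1 + G)) * V with hC₄
  set C₅ := (C * G + C * G * C₃ + 2 * C₃) * W with hC₅
  have hC₄0 : 0 < C₄ := by positivity
  have hC₅0 : 0 < C₅ := by positivity
  refine ⟨C₄ + C₅, by positivity, ?_⟩
  intro X _ _ μ Q p s v w N HN hD hsup x hx y hy
  have hne : Nonempty X := ⟨x⟩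
  obtain ⟨-, HO2, HO3⟩ := HO X μ Q p s v w N HN hD
  obtain ⟨-, H2⟩ := H X μ Q p s v w N HN
  have hQx := HN.expQ.pos x
  set α := s x - Q x / p x with hα
  set θ := 1 / p x - s x * (1 / Q x) with hθ
  have hθη : θ ≤ -η := by have := hsup x; linarith
  have hθα : θ = -(1 / Q x * α) := by
    have := HN.expP.pos x
    rw [hθ, hα]
    field_simp
    ring
  have hα0 : 0 < α := by
    by_contra! hneg
    have : 0 ≤ -(1 / Q x * α) := by
      rw [neg_nonneg]
      exact mul_nonpos_of_nonneg_of_nonpos (by positivity) hneg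
    linarith
  have hαs : α ≤ Ks.upper := by
    have h1 := HN.expS.le_upper x
    have h2 : 0 < Q x / p x := div_pos hQx (HN.expP.pos x)
    linarith
  have hαQ : 1 / Q x * α ≤ Ks.upper * (1 / KQ.lower) := by
    rw [mul_comm]
    exact mul_le_mul hαs (HN.expQ.one_div_le x) (by positivity) (hα0.le.trans hαs)
  have hfin : ∀ t j, ∃ k, j ≤ k ∧ w t ^ p t ≤ 2 ^ k := by
    intro t j
    obtain ⟨n, hn⟩ := pow_unbounded_of_one_lt (w t ^ p t) (one_lt_two (α := ℝ))
    exact ⟨j + n, by omega, hn.le.trans (pow_le_pow_right₀ (by norm_num) (by omega))⟩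
  rcases eq_or_ne x y with rfl | hxy
  · simp only [sub_self, abs_zero]
    positivity
  have hd : 0 < dist x y := dist_pos.2 hxy
  -- At large distances `d(x, y) ^ α` is bounded below, and boundedness of the oscillation of `v`
  -- suffices.
  rcases le_or_gt ((2 : ℝ) ^ (-(j₀ * (1 / Q x)))) (dist x y) with hlarge | hsmall
  · obtain ⟨c, hcN, hwc, -⟩ := HO2 ∅ (by simp)
    have hosc : ∀ t ∉ N, |v t - v c| ≤ C₂ * (1 + G) := by
      intro t ht
      obtain ⟨k, hk, hwk⟩ := hfin t j₁
      obtain ⟨n, rfl⟩ := Nat.exists_eq_add_of_le hk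
      refine (HO3 c hcN hwc t ht n hwk).trans ?_
      have hθt : 1 / p t - s t * (1 / Q t) ≤ -η := by have := hsup t; linarith
      have h1 := sum_rpow_two_le_of_neg hη hθt hk
      have h2 : (2 : ℝ) ^ (j₁ * (1 / p t - s t * (1 / Q t))) ≤ 1 :=
        Real.rpow_le_one_of_one_le_of_nonpos (by norm_num)
          (mul_nonpos_of_nonneg_of_nonpos (Nat.cast_nonneg _) (by linarith))
      gcongr
      exact h1.trans (mul_le_of_le_one_right hGpos.le h2)
    have h1 : |v x - v y| ≤ 2 * (C₂ * (1 + G)) := by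
      have e1 := hosc x hx
      have e2 := hosc y hy
      rw [abs_sub_comm] at e2
      have := abs_sub_le (v x) (v c) (v y)
      linarith
    have h2 : 1 ≤ V * dist x y ^ α := by
      calc (1 : ℝ) = 2 ^ (j₀ * (1 / Q x * α)) * 2 ^ (-(j₀ * (1 / Q x)) * α) := by
            rw [← Real.rpow_add (by norm_num)]
            ring_nf
            simp
        _ ≤ V * (2 ^ (-(j₀ * (1 / Q x)))) ^ α := by
            rw [← Real.rpow_mul (by norm_num)]
            refine mul_le_mul_of_nonneg_right ?_ (by positivity)
            exact Real.rpow_le_rpow_of_exponent_le (by norm_num)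
              (mul_le_mul_of_nonneg_left hαQ (Nat.cast_nonneg _))
        _ ≤ V * dist x y ^ α := by gcongr
    calc |v x - v y| ≤ 2 * (C₂ * (1 + G)) * 1 := by linarith
      _ ≤ 2 * (C₂ * (1 + G)) * (V * dist x y ^ α) := by gcongr
      _ = C₄ * dist x y ^ α := by ring
      _ ≤ (C₄ + C₅) * dist x y ^ α := by gcongr; linarith
  -- At small distances `j` is the level with `2 ^ (-(j + 1)) < d(x, y) ^ Q x ≤ 2 ^ (-j)`. The
  -- chains from `x` and `y` are both stopped there, and their endpoints compared by the gradient
  -- inequality.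
  · obtain ⟨j, hj1, hj2⟩ := exists_nat_pow_near_of_lt_one (x := dist x y ^ Q x)
      (y := (1 / 2 : ℝ)) (by positivity) (by
        apply Real.rpow_le_one hd.le _ hQx.le
        refine hsmall.le.trans (Real.rpow_le_one_of_one_le_of_nonpos (by norm_num) ?_)
        rw [neg_nonpos]; positivity) (by norm_num) (by norm_num)
    have hpow : ∀ i : ℕ, (1 / 2 : ℝ) ^ i = ((2 : ℝ) ^ (-(i * (1 / Q x)))) ^ Q x := by
      intro i
      rw [← Real.rpow_mul (by norm_num), neg_mul, mul_assoc, one_div_mul_cancel hQx.ne', mul_one,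
        Real.rpow_neg (by norm_num), Real.rpow_natCast, one_div, inv_pow]
    rw [hpow, Real.rpow_lt_rpow_iff (by positivity) hd.le hQx] at hj1
    rw [hpow, Real.rpow_le_rpow_iff hd.le (by positivity) hQx] at hj2
    have hj₀ : j₀ ≤ j := by
      have h1 := hj1.trans hsmall
      rw [Real.rpow_lt_rpow_left_iff (by norm_num), neg_lt_neg_iff,
        mul_lt_mul_iff_left₀ (by positivity), Nat.cast_lt] at h1
      omega
    have hτQ : τ ≤ 1 / Q x := HN.expQ.le_one_div x
    have hxyτ : dist x y ≤ 1 * 2 ^ (-(j * τ)) := by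
      rw [one_mul]
      refine hj2.trans ?_
      gcongr
      norm_num
    have hexp : (2 : ℝ) ^ (j * θ) ≤ W * dist x y ^ α := by
      have h1 : (2 : ℝ) ^ (-(j * (1 / Q x))) ≤ 2 ^ (1 / Q x) * dist x y := by
        calc (2 : ℝ) ^ (-(j * (1 / Q x))) =
              2 ^ (1 / Q x) * 2 ^ (-((j + 1 : ℕ) * (1 / Q x))) := by
              rw [← Real.rpow_add (by norm_num)]
              push_cast
              ring_nf
          _ ≤ _ := by gcongr
      calc (2 : ℝ) ^ (j * θ) = (2 ^ (-(j * (1 / Q x)))) ^ α := by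
            rw [← Real.rpow_mul (by norm_num), hθα]
            ring_nf
        _ ≤ (2 ^ (1 / Q x) * dist x y) ^ α := Real.rpow_le_rpow (by positivity) h1 hα0.le
        _ = 2 ^ (1 / Q x * α) * dist x y ^ α := by
            rw [Real.mul_rpow (by positivity) hd.le, ← Real.rpow_mul (by norm_num)]
        _ ≤ W * dist x y ^ α :=
            mul_le_mul_of_nonneg_right (Real.rpow_le_rpow_of_exponent_le (by norm_num) hαQ)
              (by positivity)
    obtain ⟨k, hk, hwk⟩ := hfin x j
    obtain ⟨l, hl, hwl⟩ := hfin y j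
    obtain ⟨x', hx'N, hx'j, hx'B, hx'C, hx'v⟩ := H2 x hx k hwk j hj₀ hk
    obtain ⟨y', hy'N, hy'j, hy'B, hy'C, hy'v⟩ := H2 y hy l hwl j hj₀ hl
    have hP0 : (0 : ℝ) < 2 ^ (-(j * τ)) := by positivity
    have near_y : dist x y ≤ (1 + B) * 2 ^ (-(j * τ)) :=
      hxyτ.trans (mul_le_mul_of_nonneg_right (by linarith) hP0.le)
    have near_x' : dist x x' ≤ (1 + B) * 2 ^ (-(j * τ)) :=
      hx'B.trans (mul_le_mul_of_nonneg_right (by linarith) hP0.le)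
    have near_y' : dist x y' ≤ (1 + B) * 2 ^ (-(j * τ)) := by
      have := dist_triangle x y y'
      linarith
    have key : ∀ t d, dist x t ≤ (1 + B) * 2 ^ (-(j * τ)) → 0 ≤ d →
        d ≤ A * 2 ^ (-(j * (1 / Q x))) → d ^ s t * 2 ^ (j * (1 / p t)) ≤ C₃ * 2 ^ (j * θ) := by
      intro t d ht hd0 hdA
      exact rpow_mul_rpow_two_le hM0 hA1 (hτ.le.trans hτQ) (HN.expQ.one_div_le x)
        (HN.expS.pos t).le (HN.expS.le_upper t)
        ((hMS X s HN.expS j x t ht).2.trans (le_max_right _ _))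
        ((hMP X p HN.expP j x t ht).1.trans (le_max_left _ _)) hd0 hdA
    have hQxy := rpow_two_le_of_mul_abs_sub_le (hMQ X Q HN.expQ j x y near_y).1
    have hPx : (0 : ℝ) < 2 ^ (-(j * (1 / Q x))) := by positivity
    -- The chain from `y` is controlled by the exponents at `y`; inserting the length `2 ^ (-j / Q
    -- y)` in `key` converts them to those at `x`.
    have hθy : (2 : ℝ) ^ (j * (1 / p y - s y * (1 / Q y))) ≤ C₃ * 2 ^ (j * θ) := by
      refine le_trans (le_of_eq ?_) (key y (2 ^ (-(j * (1 / Q y)))) near_y (by positivity) ?_)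
      · rw [← Real.rpow_mul (by norm_num), ← Real.rpow_add (by norm_num)]
        ring_nf
      · refine hQxy.trans ?_
        gcongr
        have : 0 ≤ C₁ * 2 ^ MQ := by positivity
        linarith
    have hd' : dist x' y' ≤ A * 2 ^ (-(j * (1 / Q x))) := by
      have h1 := dist_triangle4 x' x y y'
      rw [dist_comm x' x] at h1
      have h2 : C₁ * 2 ^ (-(j * (1 / Q y))) ≤ C₁ * (2 ^ MQ * 2 ^ (-(j * (1 / Q x)))) := by gcongr
      have h3 : 0 ≤ (2 : ℝ) ^ MQ * 2 ^ (-(j * (1 / Q x))) := by positivity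
      rw [hA]
      linarith
    have hx'y' : |v x' - v y'| ≤ 2 * C₃ * 2 ^ (j * θ) := by
      have e1 := (mul_le_mul_of_nonneg_left
        (le_rpow_div_of_rpow_le (HN.nonneg x') (HN.expP.pos x') hx'j)
        (show 0 ≤ dist x' y' ^ s x' by positivity)).trans (key x' _ near_x' dist_nonneg hd')
      have e2 := (mul_le_mul_of_nonneg_left
        (le_rpow_div_of_rpow_le (HN.nonneg y') (HN.expP.pos y') hy'j)
        (show 0 ≤ dist x' y' ^ s y' by positivity)).trans (key y' _ near_y' dist_nonneg hd')
      have := HN.gradient x' hx'N y' hy'N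
      linarith
    have hxx' : |v x - v x'| ≤ C * G * 2 ^ (j * θ) := by
      refine hx'v.trans ?_
      rw [mul_assoc]
      gcongr
      exact sum_rpow_two_le_of_neg hη hθη hk
    have hyy' : |v y - v y'| ≤ C * G * C₃ * 2 ^ (j * θ) := by
      refine hy'v.trans ?_
      rw [mul_assoc, mul_assoc]
      gcongr
      have hθt : 1 / p y - s y * (1 / Q y) ≤ -η := by have := hsup y; linarith
      exact (sum_rpow_two_le_of_neg hη hθt hl).trans (by gcongr)
    calc |v x - v y| ≤ |v x - v x'| + |v x' - v y'| + |v y - v y'| := by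
          have e1 := abs_sub_le (v x) (v x') (v y)
          have e2 := abs_sub_le (v x') (v y') (v y)
          rw [abs_sub_comm (v y') (v y)] at e2
          linarith
      _ ≤ (C * G + C * G * C₃ + 2 * C₃) * 2 ^ (j * θ) := by linarith
      _ ≤ (C * G + C * G * C₃ + 2 * C₃) * (W * dist x y ^ α) := by gcongr
      _ = C₅ * dist x y ^ α := by ring
      _ ≤ (C₄ + C₅) * dist x y ^ α := by gcongr; linarith

/-! ### Modulars and Luxemburg quasi-norms -/

lemma ofReal_toReal_rpow_le {p : X → ℝ} {f : X → ℝ≥0∞} (hp : ∀ x, 0 < p x) (x : X) :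
    ENNReal.ofReal ((f x).toReal ^ p x) ≤ f x ^ p x := by
  rw [← ENNReal.ofReal_rpow_of_nonneg ENNReal.toReal_nonneg (hp x).le]
  exact ENNReal.rpow_le_rpow ENNReal.ofReal_toReal_le (hp x).le

lemma IsUniformExponent.admissible [MetricSpace X] {K : ExpBounds} {p : X → ℝ} [Nonempty X] (hp : IsUniformExponent K p) :
    K.Admissible :=
  ⟨hp.lower_pos, (hp.lower_le (Classical.arbitrary X)).trans (hp.le_upper _), hp.logHolder.1⟩

lemma absSub_eq_ofReal {u : X → EReal} {x : X} (hx : u x = ((u x).toReal : EReal)) (c : ℝ) :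
    absSub u c x = ENNReal.ofReal |(u x).toReal - c| := by
  rw [absSub, hx, ← EReal.coe_sub, EReal.abs_def, EReal.toReal_coe]

section Luxemburg

variable [MeasurableSpace X] {μ : Measure X} {p : X → ℝ} {f : X → ℝ≥0∞}

lemma modular_div_mono (hp : ∀ x, 0 < p x) {t t' : ℝ≥0∞} (htt' : t ≤ t')
    (h : modular μ p (fun x => f x / t) ≤ 1) : modular μ p (fun x => f x / t') ≤ 1 := by
  refine le_trans (lintegral_mono fun x => ?_) h
  exact ENNReal.rpow_le_rpow (ENNReal.div_le_div_left htt' _) (hp x).le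

/-- To bound a quantity by the Luxemburg norm it suffices to bound it by all admissible scales. -/
lemma le_mul_luxNorm {a c : ℝ≥0∞} (hc : c ≠ 0) (hc' : c ≠ ∞)
    (h : ∀ t : ℝ, 0 < t → modular μ p (fun x => f x / ENNReal.ofReal t) ≤ 1 →
      a ≤ c * ENNReal.ofReal t) : a ≤ c * luxNorm μ p f := by
  rw [mul_comm, ← ENNReal.div_le_iff_le_mul (Or.inl hc) (Or.inl hc')]
  refine le_sInf fun t ⟨ht0, ht, hm⟩ => ?_
  rw [ENNReal.div_le_iff_le_mul (Or.inl hc) (Or.inl hc'), mul_comm]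
  have hofReal : ENNReal.ofReal t.toReal = t := ENNReal.ofReal_toReal ht.ne
  have := h t.toReal (ENNReal.toReal_pos ht0.ne' ht.ne)
  rw [hofReal] at this
  exact this hm

lemma luxNorm_le_ofReal {t : ℝ} (ht : 0 < t)
    (h : modular μ p (fun x => f x / ENNReal.ofReal t) ≤ 1) : luxNorm μ p f ≤ ENNReal.ofReal t :=
  sInf_le ⟨ENNReal.ofReal_pos.2 ht, ENNReal.ofReal_lt_top, h⟩

/-- With `T = (1 + I) ^ (1 / l) ≥ 1` one has `T ^ p x ≥ T ^ l = 1 + I`, so dividing by `T` reduces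
the modular `I` to at most `I / (1 + I)`. -/
lemma exists_modular_div_le_one {l : ℝ} (hl : 0 < l) (hp : ∀ x, l ≤ p x)
    (hf : modular μ p f < ∞) :
    ∃ t : ℝ, 0 < t ∧ modular μ p (fun x => f x / ENNReal.ofReal t) ≤ 1 := by
  set I := modular μ p f with hI
  have hI1 : 1 + I ≠ ∞ := by finiteness
  have hI0 : 1 ≤ 1 + I := le_self_add
  set T := (1 + I) ^ (1 / l) with hT
  have hTtop : T ≠ ∞ := ENNReal.rpow_ne_top_of_nonneg (by positivity) hI1
  have hT1 : 1 ≤ T := ENNReal.one_le_rpow hI0 (by positivity)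
  refine ⟨T.toReal, ENNReal.toReal_pos (by positivity) hTtop, ?_⟩
  rw [ENNReal.ofReal_toReal hTtop]
  calc modular μ p (fun x => f x / T) ≤ ∫⁻ x, (1 + I)⁻¹ * f x ^ p x ∂μ := by
        refine lintegral_mono fun x => ?_
        have hpx : 0 < p x := hl.trans_le (hp x)
        have h1 : 1 + I ≤ T ^ p x := by
          calc 1 + I = T ^ l := by
                rw [hT, ← ENNReal.rpow_mul, one_div_mul_cancel hl.ne', ENNReal.rpow_one]
            _ ≤ T ^ p x := ENNReal.rpow_le_rpow_of_exponent_le hT1 (hp x)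
        simp only
        rw [ENNReal.div_rpow_of_nonneg _ _ hpx.le, mul_comm, ← div_eq_mul_inv]
        exact ENNReal.div_le_div_left h1 _
    _ = (1 + I)⁻¹ * I := lintegral_const_mul' _ _ (by simp)
    _ ≤ (1 + I)⁻¹ * (1 + I) := by gcongr; exact le_add_self
    _ = 1 := ENNReal.inv_mul_cancel (by positivity) hI1

/-- A near-optimal scale replaces attainment of the infimum; positivity of the norm makes `‖f‖ < 2
‖f‖` strict. -/
lemma exists_modular_div_le_one_of_luxNorm_pos (h0 : 0 < luxNorm μ p f) (h : luxNorm μ p f < ∞) :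
    ∃ t : ℝ, 0 < t ∧ t ≤ 2 * (luxNorm μ p f).toReal ∧
      modular μ p (fun x => f x / ENNReal.ofReal t) ≤ 1 := by
  have hlt : luxNorm μ p f < 2 * luxNorm μ p f := by
    rw [two_mul]
    exact ENNReal.lt_add_right h.ne h0.ne'
  obtain ⟨t, ⟨ht0, ht, hm⟩, htl⟩ := sInf_lt_iff.1 hlt
  refine ⟨t.toReal, ENNReal.toReal_pos ht0.ne' ht.ne, ?_, ?_⟩
  · have := ENNReal.toReal_mono (ENNReal.mul_ne_top ENNReal.ofNat_ne_top h.ne) htl.le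
    simpa using this
  · rwa [ENNReal.ofReal_toReal ht.ne]

lemma luxNorm_lt_top {l : ℝ} (hl : 0 < l) (hp : ∀ x, l ≤ p x) (hf : modular μ p f < ∞) :
    luxNorm μ p f < ∞ := by
  obtain ⟨t, ht, hm⟩ := exists_modular_div_le_one hl hp hf
  exact (luxNorm_le_ofReal ht hm).trans_lt ENNReal.ofReal_lt_top

lemma lintegral_toReal_rpow_le (hp : ∀ x, 0 < p x) (h : modular μ p f ≤ 1) :
    ∫⁻ x, ENNReal.ofReal ((f x).toReal ^ p x) ∂μ ≤ 1 :=
  (lintegral_mono fun x => ofReal_toReal_rpow_le hp x).trans h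

/-- Chebyshev's inequality for `f ^ p`. -/
lemma measure_level_le (hf : Measurable f) (hpm : Measurable p) (hp : ∀ x, 0 < p x)
    (h : modular μ p f ≤ 1) (j : ℕ) :
    μ {x | (2 : ℝ) ^ j < (f x).toReal ^ p x} ≤ ENNReal.ofReal (2 ^ (-(j : ℝ))) := by
  have h1 := meas_ge_le_lintegral_div (μ := μ) (hf.pow hpm).aemeasurable
    (ε := ENNReal.ofReal (2 ^ j)) (by simp) (by simp)
  refine (measure_mono fun x hx => ?_).trans (h1.trans ?_)
  · exact (ENNReal.ofReal_le_ofReal (le_of_lt hx)).trans (ofReal_toReal_rpow_le hp x)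
  · refine (ENNReal.div_le_div_right h _).trans (le_of_eq ?_)
    rw [one_div, ← ENNReal.ofReal_inv_of_pos (by positivity), Real.rpow_neg (by norm_num),
      Real.rpow_natCast]

/-- Pointwise domination by a power of an integrable function bounds the Luxemburg norm. -/
lemma luxNorm_le_of_rpow_bound [IsFiniteMeasure μ] {γ h : X → ℝ} {γ₀ K : ℝ} (hγ₀ : 0 < γ₀)
    (hγ : ∀ x, γ₀ ≤ γ x) (hK : 0 < K) (h0 : ∀ x, 0 ≤ h x)
    (hint : ∫⁻ x, ENNReal.ofReal (h x) ∂μ ≤ 1)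
    (hf : ∀ᵐ x ∂μ, f x ≤ ENNReal.ofReal (K * (1 + h x) ^ (1 / γ x))) :
    luxNorm μ γ f ≤ ENNReal.ofReal (K * (1 + μ.real univ) ^ (1 / γ₀)) := by
  set m := μ.real univ with hm
  have hm0 : 0 ≤ m := measureReal_nonneg
  -- As `γ ≥ γ₀`, raising `(1 + m) ^ (1 / γ₀)` to the power `γ x` gives at least `1 + m`, which
  -- compensates `∫ (1 + h) ≤ m + 1`.
  have hT : 0 < K * (1 + m) ^ (1 / γ₀) := by positivity
  apply luxNorm_le_ofReal hT
  calc modular μ γ (fun x => f x / ENNReal.ofReal (K * (1 + m) ^ (1 / γ₀)))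
      ≤ ∫⁻ x, ENNReal.ofReal ((1 + m)⁻¹) * (1 + ENNReal.ofReal (h x)) ∂μ := by
        refine lintegral_mono_ae ?_
        filter_upwards [hf] with x hx
        have hγx : 0 < γ x := hγ₀.trans_le (hγ x)
        have hh := h0 x
        calc (f x / ENNReal.ofReal (K * (1 + m) ^ (1 / γ₀))) ^ γ x
            ≤ (ENNReal.ofReal (K * (1 + h x) ^ (1 / γ x)) /
                ENNReal.ofReal (K * (1 + m) ^ (1 / γ₀))) ^ γ x := by gcongr
          _ = ENNReal.ofReal (((1 + h x) ^ (1 / γ x) / (1 + m) ^ (1 / γ₀)) ^ γ x) := by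
              rw [← ENNReal.ofReal_div_of_pos hT, ENNReal.ofReal_rpow_of_nonneg (by positivity)
                hγx.le, mul_div_mul_left _ _ hK.ne']
          _ ≤ ENNReal.ofReal ((1 + m)⁻¹ * (1 + h x)) := by
              apply ENNReal.ofReal_le_ofReal
              rw [Real.div_rpow (by positivity) (by positivity), ← Real.rpow_mul (by positivity),
                ← Real.rpow_mul (by positivity), one_div_mul_cancel hγx.ne', Real.rpow_one,
                inv_mul_eq_div, one_div_mul_eq_div]
              gcongr
              refine Real.self_le_rpow_of_one_le (by linarith) ?_
              rw [one_le_div hγ₀]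
              exact hγ x
          _ = ENNReal.ofReal ((1 + m)⁻¹) * (1 + ENNReal.ofReal (h x)) := by
              rw [ENNReal.ofReal_mul (by positivity), ENNReal.ofReal_add zero_le_one hh,
                ENNReal.ofReal_one]
    _ = ENNReal.ofReal ((1 + m)⁻¹) * (μ univ + ∫⁻ x, ENNReal.ofReal (h x) ∂μ) := by
        rw [lintegral_const_mul' _ _ (by simp), lintegral_add_left measurable_const, lintegral_one]
    _ ≤ ENNReal.ofReal ((1 + m)⁻¹) * ENNReal.ofReal (1 + m) := by
        gcongr
        rw [add_comm, ENNReal.ofReal_add zero_le_one hm0, ENNReal.ofReal_one, hm,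
          ofReal_measureReal]
        gcongr
    _ = 1 := by
        rw [← ENNReal.ofReal_mul (by positivity), inv_mul_cancel₀ (by positivity),
          ENNReal.ofReal_one]

/-- Deviation of the mean from a constant. -/
lemma abs_average_sub_le [IsFiniteMeasure μ] [NeZero μ] {V F : X → ℝ} {c : ℝ}
    (hV : Integrable V μ) (hF : Integrable F μ) (h : ∀ᵐ x ∂μ, |V x - c| ≤ F x) :
    |(⨍ x, V x ∂μ) - c| ≤ ⨍ x, F x ∂μ := by
  have h1 : (⨍ x, V x ∂μ) - c = ⨍ x, (V x - c) ∂μ := by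
    rw [average_eq, average_eq, integral_sub hV (integrable_const c), integral_const, smul_sub,
      smul_smul, inv_mul_cancel₀ (by simp [measureReal_def, ENNReal.toReal_eq_zero_iff, NeZero.ne]),
      one_smul]
  rw [h1, average_eq, average_eq, ← Real.norm_eq_abs, norm_smul, smul_eq_mul, Real.norm_eq_abs,
    abs_of_nonneg (by positivity)]
  gcongr
  exact norm_integral_le_of_norm_le hF h

end Luxemburg

/-! ### Rescaling to modular at most one -/

section Normalize

variable [MetricSpace X] [MeasurableSpace X] {μ : Measure X}
  {Q p s : X → ℝ} {b δ D : ℝ} {KQ Kp Ks : ExpBounds}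

lemma Setting.dist_le (h : Setting μ Q p s b δ D KQ Kp Ks) (x y : X) : dist x y ≤ D := by
  rw [← h.diam_eq]
  exact Metric.dist_le_diam_of_mem h.bounded (mem_univ x) (mem_univ y)

lemma Setting.isOpenPosMeasure (h : Setting μ Q p s b δ D KQ Kp Ks) : μ.IsOpenPosMeasure :=
  h.metricMeasure.isOpenPosMeasure

lemma Setting.isFiniteMeasure [Nonempty X] (h : Setting μ Q p s b δ D KQ Kp Ks) :
    IsFiniteMeasure μ where
  measure_univ_lt_top := by
    have x := Classical.arbitrary X
    have hD : 0 ≤ D := dist_nonneg.trans (h.dist_le x x)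
    have hball : Metric.ball x (D + 1) = univ :=
      eq_univ_of_forall fun y => by
        rw [Metric.mem_ball]
        linarith [h.dist_le y x]
    rw [← hball]
    exact (h.metricMeasure x (D + 1) (by linarith)).2

lemma Setting.uniformQ (h : Setting μ Q p s b δ D KQ Kp Ks) : IsUniformExponent KQ Q :=
  have := h.isOpenPosMeasure
  h.expQ.isUniformExponent

lemma Setting.uniformP (h : Setting μ Q p s b δ D KQ Kp Ks) : IsUniformExponent Kp p :=
  have := h.isOpenPosMeasure
  h.expP.isUniformExponent

lemma Setting.uniformS (h : Setting μ Q p s b δ D KQ Kp Ks) : IsUniformExponent Ks s :=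
  have := h.isOpenPosMeasure
  h.expS.isUniformExponent

/-- Rescaling a function and its gradient to gradients of modular at most one, with one
exceptional set for all scales. -/
lemma Setting.exists_normalizedPair (h : Setting μ Q p s b δ D KQ Kp Ks) {u : X → EReal}
    {g : X → ℝ≥0∞} (hu : u ∈ HomSobolev μ s p) (hg : g ∈ ScalarGradients μ s u)
    (hgm : MemVarLp μ p g) :
    ∃ N : Set X, μ N = 0 ∧ (∀ x ∉ N, u x = ((u x).toReal : EReal)) ∧
      ∀ t : ℝ, 0 < t → modular μ p (fun x => g x / ENNReal.ofReal t) ≤ 1 →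
        NormalizedPair μ Q p s b δ KQ Kp Ks (fun x => (u x).toReal / t)
          (fun x => (g x / ENNReal.ofReal t).toReal) N := by
  obtain ⟨-, hfin, -⟩ := hu
  obtain ⟨N₀, hN₀, hgrad⟩ := hg
  obtain ⟨hgmeas, hgmod⟩ := hgm
  have hgfin : ∀ᵐ x ∂μ, g x ≠ ∞ := by
    filter_upwards [ae_lt_top (hgmeas.pow h.expP.measurable) hgmod.ne] with x hx hgx
    rw [hgx, ENNReal.top_rpow_of_pos (h.expP.pos x)] at hx
    exact hx.ne rfl
  set N := N₀ ∪ {x | ¬ ((u x ≠ ⊤ ∧ u x ≠ ⊥) ∧ g x ≠ ∞)} with hN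
  have hN0 : μ N = 0 := measure_union_null hN₀ (ae_iff.1 (hfin.and hgfin))
  have hmem : ∀ x ∉ N, x ∉ N₀ ∧ u x ≠ ⊤ ∧ u x ≠ ⊥ ∧ g x ≠ ∞ := by
    intro x hx
    simp only [hN, mem_union, mem_ofPred_eq, not_or, not_not] at hx
    exact ⟨hx.1, hx.2.1.1, hx.2.1.2, hx.2.2⟩
  have hcoe : ∀ x ∉ N, u x = ((u x).toReal : EReal) := fun x hx =>
    (EReal.coe_toReal (hmem x hx).2.1 (hmem x hx).2.2.1).symm
  refine ⟨N, hN0, hcoe, fun t ht hmod => ?_⟩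
  refine ⟨h.uniformQ, h.uniformP, h.uniformS, h.lowerRegular, hN0,
    fun x => ENNReal.toReal_nonneg, fun x hx y hy => ?_, ?_⟩
  · have h1 := hgrad x (hmem x hx).1 y (hmem y hy).1
    have hgx := (hmem x hx).2.2.2
    have hgy := (hmem y hy).2.2.2
    rw [hcoe x hx, hcoe y hy, ← EReal.coe_sub, EReal.abs_def, ← ENNReal.ofReal_toReal hgx,
      ← ENNReal.ofReal_toReal hgy, ← ENNReal.ofReal_mul (by positivity),
      ← ENNReal.ofReal_mul (by positivity), ← ENNReal.ofReal_add (by positivity) (by positivity),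
      ENNReal.ofReal_le_ofReal_iff (by positivity)] at h1
    simp only [ENNReal.toReal_div, ENNReal.toReal_ofReal ht.le]
    rw [← sub_div, abs_div, abs_of_pos ht, mul_div_assoc', mul_div_assoc', ← add_div]
    gcongr
  · exact measure_level_le (hgmeas.div_const _) h.expP.measurable h.expP.pos hmod

end Normalize

/-! ### The Sobolev inequalities -/

/-- The two norms are treated one at a time, the other summand being moved across by truncated
subtraction. -/
lemma le_mul_luxNorm_add [MeasurableSpace X] {μ : Measure X} {p : X → ℝ} {f g : X → ℝ≥0∞}
    {a c : ℝ≥0∞} (hc : c ≠ 0) (hc' : c ≠ ∞)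
    (h : ∀ t t' : ℝ, 0 < t → 0 < t' → modular μ p (fun x => f x / ENNReal.ofReal t) ≤ 1 →
      modular μ p (fun x => g x / ENNReal.ofReal t') ≤ 1 → a ≤ c * ENNReal.ofReal (t + t')) :
    a ≤ c * (luxNorm μ p f + luxNorm μ p g) := by
  rw [mul_add, add_comm, ← tsub_le_iff_left]
  refine le_mul_luxNorm hc hc' fun t ht hmt => ?_
  rw [tsub_le_iff_left, add_comm, ← tsub_le_iff_left]
  refine le_mul_luxNorm hc hc' fun t' ht' hmt' => ?_
  rw [tsub_le_iff_left, ← mul_add, ← ENNReal.ofReal_add ht.le ht'.le]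
  exact h t t' ht ht' hmt hmt'

lemma eReal_abs_eq_ofReal {u : X → EReal} {x : X} (hx : u x = ((u x).toReal : EReal)) :
    (u x).abs = ENNReal.ofReal |(u x).toReal| := by
  rw [hx, EReal.abs_def, EReal.toReal_coe]

theorem sobolev_inequalities {b δ D : ℝ} (hb : 0 < b) (hb1 : b ≤ 1) (hδ : 0 < δ)
    (KQ Kp Ks : ExpBounds) (m : ℝ) {ε : ℝ} (hε : 0 < ε) :
    ∃ CS : ℝ, 0 < CS ∧
      ∀ (X : Type v) [MetricSpace X] [MeasurableSpace X] [BorelSpace X] [Nonempty X]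
        (μ : Measure X) (Q p s : X → ℝ), Setting μ Q p s b δ D KQ Kp Ks →
        μ univ = ENNReal.ofReal m → (∀ᵐ x ∂μ, ε ≤ Q x - s x * p x) →
        (∀ u ∈ HomSobolev μ s p, ∀ g ∈ ScalarGradients μ s u, MemVarLp μ p g →
          ⨅ c : ℝ, luxNorm μ (fun x => Q x * p x / (Q x - s x * p x)) (absSub u c)
            ≤ ENNReal.ofReal CS * luxNorm μ p g) ∧
        (∀ u ∈ Sobolev μ s p, ∀ g ∈ ScalarGradients μ s u, MemVarLp μ p g →
          luxNorm μ (fun x => Q x * p x / (Q x - s x * p x)) (fun x => (u x).abs)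
            ≤ ENNReal.ofReal CS * (luxNorm μ p (fun x => (u x).abs) + luxNorm μ p g)) := by
  -- Inconsistent data are realized by no nonempty space, so any constant will do.
  by_cases hadm : KQ.Admissible ∧ Kp.Admissible
  swap
  · exact ⟨1, one_pos, fun X _ _ _ _ μ Q p s h => absurd
      ⟨h.uniformQ.admissible, h.uniformP.admissible⟩ hadm⟩
  obtain ⟨hQ, hP⟩ := hadm
  obtain ⟨j₀, C, hC, H⟩ := exists_oscillation_bound.{v} (D := D) (Kp := Kp) (Ks := Ks) hb hb1 hδ hQ
  have hpl := hP.lower_pos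
  have hθ₀ : 0 < ε / (KQ.upper * Kp.upper) := div_pos hε (mul_pos hQ.upper_pos hP.upper_pos)
  set θ₀ := ε / (KQ.upper * Kp.upper) with hθ₀def
  set θ₁ := 1 / Kp.lower with hθ₁
  have hG : 0 < ((2 : ℝ) ^ θ₀ - 1)⁻¹ :=
    inv_pos.2 (by linarith [Real.one_lt_rpow (show (1 : ℝ) < 2 by norm_num) hθ₀])
  set K := C * (1 + ((2 : ℝ) ^ θ₀ - 1)⁻¹ * (2 ^ (j₀ * θ₁) * 2 ^ θ₁)) with hK
  have hK0 : 0 < K := by positivity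
  set W := (2 : ℝ) ^ (j₀ * θ₁) with hW
  have hW0 : 0 < W := by positivity
  set m' := (ENNReal.ofReal m).toReal with hm'
  have hm'0 : 0 ≤ m' := ENNReal.toReal_nonneg
  have hCS : 0 < (K + W) * (1 + m') ^ (1 / Kp.lower) := by positivity
  refine ⟨(K + W) * (1 + m') ^ (1 / Kp.lower), hCS, ?_⟩
  intro X _ _ _ _ μ Q p s hset hμ hsub
  have := hset.isOpenPosMeasure
  have := hset.isFiniteMeasure
  have hreal : μ.real univ = m' := by rw [measureReal_def, hμ]
  have uQ := hset.uniformQ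
  have uP := hset.uniformP
  have uS := hset.uniformS
  have hsub' : ∀ x, ε ≤ Q x - s x * p x := forall_le_of_ae_le continuous_const
    (uQ.continuous.sub (uS.continuous.mul uP.continuous)) hsub
  set γ : X → ℝ := fun x => Q x * p x / (Q x - s x * p x) with hγ
  -- The growth exponent of the chain is exactly `1 / γ`.
  have hγθ : ∀ x, 1 / p x - s x * (1 / Q x) = 1 / γ x := by
    intro x
    have h1 := uQ.pos x
    have h2 := uP.pos x
    rw [hγ]
    simp only
    rw [one_div_div]
    field_simp
  have hθlow : ∀ x, θ₀ ≤ 1 / γ x := by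
    intro x
    rw [hγ]
    simp only
    rw [one_div_div, hθ₀def]
    have h1 := uQ.pos x
    have h2 := uP.pos x
    have h3 := uQ.le_upper x
    have h4 := uP.le_upper x
    have h5 := hsub' x
    have h7 := hε.le.trans h5
    have h6 := hQ.upper_pos
    gcongr
  have hθhigh : ∀ x, 1 / γ x ≤ θ₁ := by
    intro x
    rw [← hγθ]
    have h1 := uP.one_div_le x
    have h2 := uS.pos x
    have h3 := uQ.pos x
    have : 0 ≤ s x * (1 / Q x) := by positivity
    linarith
  have hγlow : ∀ x, Kp.lower ≤ γ x := by
    intro x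
    have h1 : 0 < γ x := one_div_pos.1 (hθ₀.trans_le (hθlow x))
    exact (one_div_le_one_div h1 hpl).1 (hθhigh x)
  have osc : ∀ (u : X → EReal) (g : X → ℝ≥0∞) (N : Set X) (t : ℝ), 0 < t →
      NormalizedPair μ Q p s b δ KQ Kp Ks (fun x => (u x).toReal / t)
          (fun x => (g x / ENNReal.ofReal t).toReal) N →
      (∀ F : Set X, μ F ≤ ENNReal.ofReal (2 ^ (-(j₀ : ℝ))) → ∃ c ∉ N, c ∉ F ∧
        ∀ x ∉ N, |(u x).toReal - (u c).toReal| ≤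
          t * K * (1 + (g x / ENNReal.ofReal t).toReal ^ p x) ^ (1 / γ x)) := by
    intro u g N t ht hN F hF
    obtain ⟨-, h2, h3⟩ := H X μ Q p s _ _ N hN hset.dist_le
    obtain ⟨c, hcN, hwc, hcF⟩ := h2 F hF
    refine ⟨c, hcN, hcF, fun x hx => ?_⟩
    have hh : 0 ≤ (g x / ENNReal.ofReal t).toReal ^ p x :=
      Real.rpow_nonneg ENNReal.toReal_nonneg _
    obtain ⟨n, hn, hsum⟩ := exists_sum_rpow_two_le_of_pos hθ₀ (hθlow x) (hθhigh x) hh j₀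
    have h4 := h3 c hcN hwc x hx n hn
    simp only [hγθ] at h4
    rw [← sub_div, abs_div, abs_of_pos ht, div_le_iff₀ ht] at h4
    calc _ ≤ _ := h4
      _ ≤ (C * ((1 + ((2 : ℝ) ^ θ₀ - 1)⁻¹ * (2 ^ (j₀ * θ₁) * 2 ^ θ₁)) *
            (1 + (g x / ENNReal.ofReal t).toReal ^ p x) ^ (1 / γ x))) * t := by gcongr
      _ = _ := by rw [hK]; ring
  constructor
  · intro u hu g hg hgm
    obtain ⟨N, hN0, hcoe, hnorm⟩ := hset.exists_normalizedPair hu hg hgm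
    refine le_mul_luxNorm (by simpa using hCS) ENNReal.ofReal_ne_top fun t ht hmod => ?_
    obtain ⟨c, hcN, -, hosc⟩ := osc u g N t ht (hnorm t ht hmod) ∅ (by simp)
    refine (iInf_le _ ((u c).toReal)).trans ?_
    have hlux := luxNorm_le_of_rpow_bound (μ := μ) (f := absSub u (u c).toReal)
      (h := fun x => (g x / ENNReal.ofReal t).toReal ^ p x) hpl hγlow (mul_pos ht hK0)
      (fun x => Real.rpow_nonneg ENNReal.toReal_nonneg _)
      (lintegral_toReal_rpow_le uP.pos hmod) (by
        filter_upwards [compl_mem_ae_iff.2 hN0] with x hx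
        rw [absSub_eq_ofReal (hcoe x hx)]
        exact ENNReal.ofReal_le_ofReal (hosc x hx))
    refine hlux.trans ?_
    rw [hreal, ← ENNReal.ofReal_mul hCS.le]
    apply ENNReal.ofReal_le_ofReal
    calc t * K * (1 + m') ^ (1 / Kp.lower) = K * (1 + m') ^ (1 / Kp.lower) * t := by ring
      _ ≤ (K + W) * (1 + m') ^ (1 / Kp.lower) * t := by gcongr; linarith
  · intro u hu g hg hgm
    obtain ⟨N, hN0, hcoe, hnorm⟩ := hset.exists_normalizedPair hu.1 hg hgm
    refine le_mul_luxNorm_add (by simpa using hCS) ENNReal.ofReal_ne_top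
      fun t₁ t₂ ht₁ ht₂ hmod₁ hmod₂ => ?_
    -- A common scale, at which both `u / t` and `g / t` have modular at most one.
    set t := t₁ + t₂ with ht_def
    have ht : 0 < t := by positivity
    have hmodu := modular_div_mono uP.pos (ENNReal.ofReal_le_ofReal (show t₁ ≤ t by linarith)) hmod₁
    have hmod := modular_div_mono uP.pos (ENNReal.ofReal_le_ofReal (show t₂ ≤ t by linarith)) hmod₂
    -- The reference point also avoids the set where `|u / t| ^ p` is large, so `|u c| ≤ t * W` and
    -- no constant need be subtracted.
    obtain ⟨c, hcN, hcF, hosc⟩ := osc u g N t ht (hnorm t ht hmod) _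
      (measure_level_le (hu.2.1.div_const _) hset.expP.measurable uP.pos hmodu j₀)
    have huc : |(u c).toReal| ≤ t * W := by
      simp only [mem_ofPred_eq, not_lt] at hcF
      have h1 := le_rpow_div_of_rpow_le ENNReal.toReal_nonneg (uP.pos c) hcF
      rw [eReal_abs_eq_ofReal (hcoe c hcN), ENNReal.toReal_div, ENNReal.toReal_ofReal ht.le,
        ENNReal.toReal_ofReal (abs_nonneg _), div_le_iff₀ ht, mul_comm] at h1
      refine h1.trans (mul_le_mul_of_nonneg_left ?_ ht.le)
      exact Real.rpow_le_rpow_of_exponent_le (by norm_num)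
        (mul_le_mul_of_nonneg_left (uP.one_div_le c) (Nat.cast_nonneg _))
    have hlux := luxNorm_le_of_rpow_bound (μ := μ) (f := fun x => (u x).abs)
      (h := fun x => (g x / ENNReal.ofReal t).toReal ^ p x) hpl hγlow
      (mul_pos ht (add_pos hK0 hW0))
      (fun x => Real.rpow_nonneg ENNReal.toReal_nonneg _)
      (lintegral_toReal_rpow_le uP.pos hmod) (by
        filter_upwards [compl_mem_ae_iff.2 hN0] with x hx
        rw [eReal_abs_eq_ofReal (hcoe x hx)]
        apply ENNReal.ofReal_le_ofReal
        have h1 := hosc x hx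
        have hh : 0 ≤ (g x / ENNReal.ofReal t).toReal ^ p x :=
          Real.rpow_nonneg ENNReal.toReal_nonneg _
        have h2 : 1 ≤ (1 + (g x / ENNReal.ofReal t).toReal ^ p x) ^ (1 / γ x) :=
          Real.one_le_rpow (by linarith) (hθ₀.le.trans (hθlow x))
        have h3 := abs_sub_abs_le_abs_sub (u x).toReal (u c).toReal
        have h4 : t * W * 1 ≤ t * W * (1 + (g x / ENNReal.ofReal t).toReal ^ p x) ^ (1 / γ x) := by
          gcongr
        linarith)
    refine hlux.trans (le_of_eq ?_)
    rw [hreal, ← ENNReal.ofReal_mul hCS.le]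
    congr 1
    ring

/-! ### The Moser-Trudinger inequality -/

theorem moser_trudinger {b δ D : ℝ} (hb : 0 < b) (hb1 : b ≤ 1) (hδ : 0 < δ)
    (KQ Kp Ks : ExpBounds) :
    ∃ CMT1 CMT2 : ℝ, 0 < CMT1 ∧ 0 < CMT2 ∧
      ∀ (X : Type v) [MetricSpace X] [MeasurableSpace X] [BorelSpace X] [Nonempty X]
        (μ : Measure X) (Q p s : X → ℝ), Setting μ Q p s b δ D KQ Kp Ks →
        (∀ x, s x * p x = Q x) →
        ∀ u ∈ HomSobolev μ s p, ∀ g ∈ ScalarGradients μ s u, MemVarLp μ p g →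
          Integrable (fun x => (u x).toReal) μ ∧
          (0 < luxNorm μ p g →
            ⨍⁻ x, ENNReal.ofReal (Real.exp
                (CMT1 * (|(u x).toReal - mean μ u| / (luxNorm μ p g).toReal))) ∂μ
              ≤ ENNReal.ofReal CMT2) := by
  by_cases hQ : KQ.Admissible
  swap
  · exact ⟨1, 1, one_pos, one_pos, fun X _ _ _ _ μ Q p s h => absurd h.uniformQ.admissible hQ⟩
  obtain ⟨j₀, C, hC, H⟩ := exists_oscillation_bound.{v} (D := D) (Kp := Kp) (Ks := Ks) hb hb1 hδ hQ
  -- `R` bounds the average of `1 + h`: since `μ univ ≥ 2 ^ (-j₀)`, the integral of `h`, at most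
  -- one, is at most `2 ^ j₀ * μ univ`. This keeps the constants independent of the total mass.
  set R := 1 + (2 : ℝ) ^ (j₀ : ℝ) with hR
  have hR0 : 0 < R := by positivity
  set K := 2 * C * (1 + R) with hK
  have hK0 : 0 < K := by positivity
  -- The 2 absorbs `t ≤ 2 ‖g‖`; the exponent is then at most `1 + log (1 + h)`, and the exponential
  -- at most `e * (1 + h)`.
  refine ⟨1 / (2 * K), Real.exp 1 * R, by positivity, by positivity, ?_⟩
  intro X _ _ _ _ μ Q p s hset hcrit u hu g hg hgm
  have := hset.isOpenPosMeasure
  have := hset.isFiniteMeasure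
  have uP := hset.uniformP
  have uQ := hset.uniformQ
  obtain ⟨N, hN0, hcoe, hnorm⟩ := hset.exists_normalizedPair hu hg hgm
  have hNae : ∀ᵐ x ∂μ, x ∉ N := compl_mem_ae_iff.2 hN0
  have hum : Measurable fun x => (u x).toReal := hu.1.ereal_toReal
  have hwm : ∀ t : ℝ, Measurable fun x => (g x / ENNReal.ofReal t).toReal ^ p x := fun t =>
    ((hgm.1.div_const _).ennreal_toReal).pow hset.expP.measurable
  have hθ0 : ∀ x, 1 / p x - s x * (1 / Q x) = 0 := by
    intro x
    have h1 := uQ.pos x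
    have h2 := uP.pos x
    rw [sub_eq_zero, mul_one_div, div_eq_div_iff h2.ne' h1.ne', hcrit]
    ring
  have main : ∀ t : ℝ, 0 < t → modular μ p (fun x => g x / ENNReal.ofReal t) ≤ 1 →
      ENNReal.ofReal (2 ^ (-(j₀ : ℝ))) ≤ μ univ ∧
      Integrable (fun x => 1 + (g x / ENNReal.ofReal t).toReal ^ p x) μ ∧
      ∃ c : ℝ, ∀ x ∉ N, |(u x).toReal - c| ≤
        t * (2 * C) * (1 + Real.log (1 + (g x / ENNReal.ofReal t).toReal ^ p x)) := by
    intro t ht hmod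
    obtain ⟨h1, h2, h3⟩ := H X μ Q p s _ _ N (hnorm t ht hmod) hset.dist_le
    refine ⟨h1, (integrable_const 1).add ⟨(hwm t).aestronglyMeasurable, ?_⟩, ?_⟩
    · rw [hasFiniteIntegral_iff_ofReal (.of_forall fun x =>
        Real.rpow_nonneg ENNReal.toReal_nonneg _)]
      exact (lintegral_toReal_rpow_le uP.pos hmod).trans_lt ENNReal.one_lt_top
    · obtain ⟨c, hcN, hwc, -⟩ := h2 ∅ (by simp)
      refine ⟨(u c).toReal, fun x hx => ?_⟩
      have hh : 0 ≤ (g x / ENNReal.ofReal t).toReal ^ p x :=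
        Real.rpow_nonneg ENNReal.toReal_nonneg _
      obtain ⟨n, hn, hnl⟩ := exists_card_le_log hh j₀
      have h4 := h3 c hcN hwc x hx n hn
      simp only [hθ0, mul_zero, Real.rpow_zero, Finset.sum_const, Nat.card_Ico,
        add_tsub_cancel_left, nsmul_eq_mul, mul_one] at h4
      rw [← sub_div, abs_div, abs_of_pos ht, div_le_iff₀ ht] at h4
      calc _ ≤ _ := h4
        _ ≤ C * (1 + (1 + 2 * Real.log (1 + (g x / ENNReal.ofReal t).toReal ^ p x))) * t := by
          gcongr
        _ = _ := by ring
  have hlog : ∀ {h : ℝ}, 0 ≤ h → 0 ≤ Real.log (1 + h) ∧ 1 + Real.log (1 + h) ≤ 1 + h := by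
    intro h hh
    refine ⟨Real.log_nonneg (by linarith), ?_⟩
    have := Real.log_le_sub_one_of_pos (show 0 < 1 + h by linarith)
    linarith
  have hint : Integrable (fun x => (u x).toReal) μ := by
    obtain ⟨t, ht, hmod⟩ := exists_modular_div_le_one uP.lower_pos uP.lower_le hgm.2
    obtain ⟨-, hi, c, hc⟩ := main t ht hmod
    have h1 : Integrable (fun x => (u x).toReal - c) μ := by
      refine (hi.const_mul (t * (2 * C))).mono' (hum.sub_const c).aestronglyMeasurable ?_
      filter_upwards [hNae] with x hx
      refine (hc x hx).trans ?_
      have := (hlog (Real.rpow_nonneg (ENNReal.toReal_nonneg (a := g x / ENNReal.ofReal t))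
        (p x))).2
      gcongr
    exact (h1.add (integrable_const c)).congr (.of_forall fun x => sub_add_cancel _ _)
  refine ⟨hint, fun hpos => ?_⟩
  have hlt := luxNorm_lt_top uP.lower_pos uP.lower_le hgm.2
  obtain ⟨t, ht, htg, hmod⟩ := exists_modular_div_le_one_of_luxNorm_pos hpos hlt
  obtain ⟨hμ, hi, c, hc⟩ := main t ht hmod
  set h : X → ℝ := fun x => (g x / ENNReal.ofReal t).toReal ^ p x with hh_def
  have hh0 : ∀ x, 0 ≤ h x := fun x => Real.rpow_nonneg ENNReal.toReal_nonneg _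
  have hlint : ∫⁻ x, ENNReal.ofReal (1 + h x) ∂μ ≤ ENNReal.ofReal R * μ univ := by
    calc ∫⁻ x, ENNReal.ofReal (1 + h x) ∂μ = ∫⁻ x, (1 + ENNReal.ofReal (h x)) ∂μ := by
          refine lintegral_congr fun x => ?_
          rw [ENNReal.ofReal_add zero_le_one (hh0 x), ENNReal.ofReal_one]
      _ = μ univ + ∫⁻ x, ENNReal.ofReal (h x) ∂μ := by
          rw [lintegral_add_left measurable_const, lintegral_one]
      _ ≤ μ univ + 1 := by gcongr; exact lintegral_toReal_rpow_le uP.pos hmod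
      _ ≤ μ univ + ENNReal.ofReal (2 ^ (j₀ : ℝ)) * μ univ := by
          gcongr
          calc (1 : ℝ≥0∞) = ENNReal.ofReal (2 ^ (j₀ : ℝ)) * ENNReal.ofReal (2 ^ (-(j₀ : ℝ))) := by
                rw [← ENNReal.ofReal_mul (by positivity), ← Real.rpow_add (by norm_num),
                  add_neg_cancel, Real.rpow_zero, ENNReal.ofReal_one]
            _ ≤ _ := by gcongr
      _ = ENNReal.ofReal R * μ univ := by
          rw [hR, ENNReal.ofReal_add zero_le_one (by positivity), ENNReal.ofReal_one]
          ring
  have hμ0 : μ univ ≠ 0 := (lt_of_lt_of_le (ENNReal.ofReal_pos.2 (by positivity)) hμ).ne'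
  have hμreal : 0 < μ.real univ := ENNReal.toReal_pos hμ0 (measure_ne_top μ _)
  have havg : ⨍ x, (1 + h x) ∂μ ≤ R := by
    rw [average_eq, smul_eq_mul, inv_mul_le_iff₀ hμreal,
      integral_eq_lintegral_of_nonneg_ae (.of_forall fun x => by have := hh0 x; positivity)
        hi.aestronglyMeasurable]
    have := ENNReal.toReal_mono (ENNReal.mul_ne_top ENNReal.ofReal_ne_top (measure_ne_top μ _)) hlint
    rwa [ENNReal.toReal_mul, ENNReal.toReal_ofReal hR0.le, mul_comm] at this
  -- Averaging the pointwise bound lets the mean replace `c`, at the cost of the factor `1 + R` in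
  -- `K`.
  have hmean : |mean μ u - c| ≤ t * (2 * C) * R := by
    have h1 := abs_average_sub_le hint (hi.const_mul (t * (2 * C))) (c := c) (by
      filter_upwards [hNae] with x hx
      refine (hc x hx).trans ?_
      have := (hlog (hh0 x)).2
      gcongr)
    refine h1.trans ?_
    rw [average_eq, integral_const_mul, smul_eq_mul, mul_left_comm, ← smul_eq_mul (_⁻¹),
      ← average_eq]
    gcongr
  have hpt : ∀ x ∉ N, ENNReal.ofReal (Real.exp (1 / (2 * K) *
      (|(u x).toReal - mean μ u| / (luxNorm μ p g).toReal))) ≤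
        ENNReal.ofReal (Real.exp 1) * ENNReal.ofReal (1 + h x) := by
    intro x hx
    obtain ⟨l1, l2⟩ := hlog (hh0 x)
    have hg0 : 0 < (luxNorm μ p g).toReal := ENNReal.toReal_pos hpos.ne' hlt.ne
    have h1 : |(u x).toReal - mean μ u| ≤ t * K * (1 + Real.log (1 + h x)) := by
      have e1 := hc x hx
      have e2 := abs_sub_le (u x).toReal c (mean μ u)
      rw [abs_sub_comm c] at e2
      have e3 : t * (2 * C) * R * 1 ≤ t * (2 * C) * R * (1 + Real.log (1 + h x)) := by
        gcongr
        linarith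
      calc _ ≤ t * (2 * C) * (1 + Real.log (1 + h x)) +
            t * (2 * C) * R * (1 + Real.log (1 + h x)) := by linarith
        _ = _ := by rw [hK]; ring
    rw [← ENNReal.ofReal_mul (Real.exp_pos 1).le]
    apply ENNReal.ofReal_le_ofReal
    calc Real.exp (1 / (2 * K) * (|(u x).toReal - mean μ u| / (luxNorm μ p g).toReal))
        ≤ Real.exp (1 + Real.log (1 + h x)) := by
          apply Real.exp_le_exp.2
          rw [div_mul_div_comm, one_mul, div_le_iff₀ (by positivity)]
          calc _ ≤ t * K * (1 + Real.log (1 + h x)) := h1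
            _ ≤ (2 * (luxNorm μ p g).toReal) * K * (1 + Real.log (1 + h x)) := by gcongr
            _ = _ := by ring
      _ = Real.exp 1 * (1 + h x) := by
          rw [Real.exp_add, Real.exp_log (by linarith [hh0 x])]
  rw [laverage_eq]
  refine ENNReal.div_le_of_le_mul ?_
  calc _ ≤ ∫⁻ x, ENNReal.ofReal (Real.exp 1) * ENNReal.ofReal (1 + h x) ∂μ := by
        refine lintegral_mono_ae ?_
        filter_upwards [hNae] with x hx using hpt x hx
    _ = ENNReal.ofReal (Real.exp 1) * ∫⁻ x, ENNReal.ofReal (1 + h x) ∂μ :=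
        lintegral_const_mul' _ _ ENNReal.ofReal_ne_top
    _ ≤ ENNReal.ofReal (Real.exp 1) * (ENNReal.ofReal R * μ univ) := by gcongr
    _ = ENNReal.ofReal (Real.exp 1 * R) * μ univ := by
        rw [ENNReal.ofReal_mul (Real.exp_pos 1).le, mul_assoc]

/-! ### The Morrey inequality -/

/-- A function satisfying a variable Hölder estimate on a dense set extends continuously. -/
lemma exists_continuous_extension [MetricSpace X] {E : Set X} (hE : Dense E) {V α : X → ℝ}
    {K α₀ : ℝ} (hK : 0 ≤ K) (hα₀ : 0 < α₀) (hα : ∀ x, α₀ ≤ α x)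
    (h : ∀ x ∈ E, ∀ y ∈ E, |V x - V y| ≤ K * dist x y ^ α x) :
    ∃ v : X → ℝ, Continuous v ∧ ∀ x ∈ E, v x = V x := by
  have huc : UniformContinuous fun x : E => V x := by
    rw [Metric.uniformContinuous_iff]
    intro ε hε
    have hK1 : 0 < ε / (K + 1) := by positivity
    refine ⟨min 1 ((ε / (K + 1)) ^ (1 / α₀)), by positivity, fun {x y} hxy => ?_⟩
    have hd1 : dist (x : X) y ≤ 1 := (lt_of_lt_of_le hxy (min_le_left _ _)).le
    have hd2 : dist (x : X) y ≤ (ε / (K + 1)) ^ (1 / α₀) :=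
      (lt_of_lt_of_le hxy (min_le_right _ _)).le
    have h1 : dist (x : X) y ^ α x ≤ ε / (K + 1) := by
      rcases eq_or_lt_of_le (dist_nonneg (x := (x : X)) (y := y)) with h0 | h0
      · rw [← h0, Real.zero_rpow (hα₀.trans_le (hα x)).ne']
        exact hK1.le
      calc dist (x : X) y ^ α x ≤ dist (x : X) y ^ α₀ :=
            Real.rpow_le_rpow_of_exponent_ge h0 hd1 (hα x)
        _ ≤ ((ε / (K + 1)) ^ (1 / α₀)) ^ α₀ := Real.rpow_le_rpow h0.le hd2 hα₀.le
        _ = ε / (K + 1) := by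
            rw [← Real.rpow_mul hK1.le, one_div_mul_cancel hα₀.ne', Real.rpow_one]
    rw [Real.dist_eq]
    calc |V x - V y| ≤ K * (ε / (K + 1)) := (h x x.2 y y.2).trans (by gcongr)
      _ < (K + 1) * (ε / (K + 1)) := by gcongr; linarith
      _ = ε := by field_simp
  exact ⟨hE.extend fun x : E => V x, (hE.uniformContinuous_extend huc).continuous,
    fun x hx => hE.extend_eq huc.continuous ⟨x, hx⟩⟩

/-- Both sides are continuous on `X × X`, positivity of `α` being what is needed on the diagonal,
and `E ×ˢ E` is dense. -/
lemma holder_bound_of_dense [MetricSpace X] {E : Set X} (hE : Dense E) {v α : X → ℝ} {K : ℝ}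
    (hv : Continuous v) (hα : Continuous α) (hα0 : ∀ x, 0 < α x)
    (h : ∀ x ∈ E, ∀ y ∈ E, |v x - v y| ≤ K * dist x y ^ α x) (x y : X) :
    |v x - v y| ≤ K * dist x y ^ α x := by
  have hcont : Continuous fun z : X × X => K * dist z.1 z.2 ^ α z.1 :=
    continuous_const.mul (continuous_dist.rpow (hα.comp continuous_fst) fun z => Or.inr (hα0 _))
  have hclosed : IsClosed {z : X × X | |v z.1 - v z.2| ≤ K * dist z.1 z.2 ^ α z.1} :=
    isClosed_le (by fun_prop) hcont
  have hsub : E ×ˢ E ⊆ {z : X × X | |v z.1 - v z.2| ≤ K * dist z.1 z.2 ^ α z.1} :=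
    fun z hz => h z.1 hz.1 z.2 hz.2
  have := hclosed.closure_subset_iff.2 hsub
  rw [(hE.prod hE).closure_eq] at this
  exact this (mem_univ (x, y))

theorem morrey_inequality {b δ D : ℝ} (hb : 0 < b) (hb1 : b ≤ 1) (hδ : 0 < δ)
    (KQ Kp Ks : ExpBounds) {ε : ℝ} (hε : 0 < ε) :
    ∃ CH DH : ℝ, 0 < CH ∧ 0 < DH ∧
      ∀ (X : Type v) [MetricSpace X] [MeasurableSpace X] [BorelSpace X] [Nonempty X]
        (μ : Measure X) (Q p s : X → ℝ), Setting μ Q p s b δ D KQ Kp Ks →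
        (∀ᵐ x ∂μ, ε ≤ s x * p x - Q x) →
        ∀ u ∈ HomSobolev μ s p, ∀ g ∈ ScalarGradients μ s u, MemVarLp μ p g →
          Integrable (fun x => (u x).toReal) μ ∧
          essSup (absSub u (mean μ u)) μ ≤ ENNReal.ofReal CH * luxNorm μ p g ∧
          ∃ v : X → ℝ, Continuous v ∧ (∀ᵐ x ∂μ, u x = (v x : EReal)) ∧
            ∀ x y : X, ENNReal.ofReal |v x - v y|
              ≤ ENNReal.ofReal DH * luxNorm μ p g *
                ENNReal.ofReal (dist x y ^ (s x - Q x / p x)) := by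
  by_cases hadm : KQ.Admissible ∧ Kp.Admissible
  swap
  · exact ⟨1, 1, one_pos, one_pos, fun X _ _ _ _ μ Q p s h => absurd
      ⟨h.uniformQ.admissible, h.uniformP.admissible⟩ hadm⟩
  obtain ⟨hQ, hP⟩ := hadm
  have hη : 0 < ε / (KQ.upper * Kp.upper) := div_pos hε (mul_pos hQ.upper_pos hP.upper_pos)
  obtain ⟨C, hC, H⟩ := exists_holder_bound.{v} (D := D) (Kp := Kp) (Ks := Ks) hb hb1 hδ hQ hη
  have hm : 0 < max 1 D := lt_max_of_lt_left one_pos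
  -- The Hölder bound over the whole diameter, which controls the total oscillation.
  set A := C * (max 1 D) ^ Ks.upper with hA
  have hA0 : 0 < A := by positivity
  refine ⟨A, C, hA0, hC, ?_⟩
  intro X _ _ _ _ μ Q p s hset hsup u hu g hg hgm
  have := hset.isOpenPosMeasure
  have := hset.isFiniteMeasure
  have uP := hset.uniformP
  have uQ := hset.uniformQ
  have uS := hset.uniformS
  have hsup' : ∀ x, ε ≤ s x * p x - Q x := forall_le_of_ae_le continuous_const
    ((uS.continuous.mul uP.continuous).sub uQ.continuous) hsup
  obtain ⟨N, hN0, hcoe, hnorm⟩ := hset.exists_normalizedPair hu hg hgm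
  have hNae : ∀ᵐ x ∂μ, x ∉ N := compl_mem_ae_iff.2 hN0
  have hum : Measurable fun x => (u x).toReal := hu.1.ereal_toReal
  set α : X → ℝ := fun x => s x - Q x / p x with hα
  have hαε : ∀ x, ε / Kp.upper ≤ α x := by
    intro x
    have h1 := uP.pos x
    have h2 := uP.le_upper x
    have h3 := hsup' x
    have h5 := hε.le.trans h3
    have h4 : α x = (s x * p x - Q x) / p x := by
      rw [hα]
      field_simp
    rw [h4]
    gcongr
  have hα₀ : 0 < ε / Kp.upper := div_pos hε hP.upper_pos
  have hαpos : ∀ x, 0 < α x := fun x => hα₀.trans_le (hαε x)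
  have hαs : ∀ x, α x ≤ Ks.upper := by
    intro x
    have h1 := uS.le_upper x
    have h2 : 0 < Q x / p x := div_pos (uQ.pos x) (uP.pos x)
    simp only [hα]
    linarith
  have hαcont : Continuous α :=
    uS.continuous.sub (uQ.continuous.div uP.continuous fun x => (uP.pos x).ne')
  have hηx : ∀ x, ε / (KQ.upper * Kp.upper) ≤ s x * (1 / Q x) - 1 / p x := by
    intro x
    have h1 := uP.pos x
    have h2 := uQ.pos x
    have h3 := uP.le_upper x
    have h4 := uQ.le_upper x
    have h5 := hsup' x
    have h8 := hε.le.trans h5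
    have h6 := hQ.upper_pos
    have h7 : s x * (1 / Q x) - 1 / p x = (s x * p x - Q x) / (Q x * p x) := by
      field_simp
    rw [h7]
    gcongr
  have hold : ∀ t : ℝ, 0 < t → modular μ p (fun x => g x / ENNReal.ofReal t) ≤ 1 →
      ∀ x ∉ N, ∀ y ∉ N, |(u x).toReal - (u y).toReal| ≤ C * t * dist x y ^ α x := by
    intro t ht hmod x hx y hy
    have h1 := H X μ Q p s _ _ N (hnorm t ht hmod) hset.dist_le hηx x hx y hy
    rw [← sub_div, abs_div, abs_of_pos ht, div_le_iff₀ ht] at h1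
    linarith
  have hdist : ∀ x y : X, dist x y ^ α x ≤ (max 1 D) ^ Ks.upper := fun x y =>
    (Real.rpow_le_rpow dist_nonneg ((hset.dist_le x y).trans (le_max_right _ _))
      (hαpos x).le).trans (Real.rpow_le_rpow_of_exponent_le (le_max_left _ _) (hαs x))
  have hosc : ∀ t : ℝ, 0 < t → modular μ p (fun x => g x / ENNReal.ofReal t) ≤ 1 →
      ∀ x ∉ N, ∀ y ∉ N, |(u y).toReal - (u x).toReal| ≤ A * t := by
    intro t ht hmod x hx y hy
    rw [abs_sub_comm]
    refine (hold t ht hmod x hx y hy).trans ?_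
    calc C * t * dist x y ^ α x ≤ C * t * (max 1 D) ^ Ks.upper := by gcongr; exact hdist x y
      _ = A * t := by ring
  obtain ⟨t₀, ht₀, hmod₀⟩ := exists_modular_div_le_one uP.lower_pos uP.lower_le hgm.2
  have hdense : Dense Nᶜ := Measure.dense_of_ae hNae
  obtain ⟨x₀, hx₀⟩ := hdense.nonempty
  have hint : Integrable (fun x => (u x).toReal) μ := by
    have h1 : Integrable (fun x => (u x).toReal - (u x₀).toReal) μ := by
      refine (integrable_const (A * t₀)).mono' (hum.sub_const _).aestronglyMeasurable ?_
      filter_upwards [hNae] with x hx using hosc t₀ ht₀ hmod₀ x₀ hx₀ x hx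
    exact (h1.add (integrable_const (u x₀).toReal)).congr
      (.of_forall fun x => sub_add_cancel _ _)
  have : NeZero μ := ⟨fun h0 => by
    have h1 := isOpen_univ.measure_pos μ (univ_nonempty (α := X))
    simp [h0] at h1⟩
  refine ⟨hint, ?_, ?_⟩
  · refine le_mul_luxNorm (by simpa using hA0) ENNReal.ofReal_ne_top fun t ht hmod => ?_
    refine essSup_le_of_ae_le _ ?_
    filter_upwards [hNae] with x hx
    rw [absSub_eq_ofReal (hcoe x hx), ← ENNReal.ofReal_mul hA0.le, abs_sub_comm]
    apply ENNReal.ofReal_le_ofReal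
    refine (abs_average_sub_le hint (integrable_const (A * t)) ?_).trans (by simp)
    filter_upwards [hNae] with y hy using hosc t ht hmod x hx y hy
  -- The representative is built from one scale `t₀`. Its Hölder bound is then proved for every
  -- admissible `t`, so that the infimum gives the norm.
  · obtain ⟨v, hv, hvu⟩ := exists_continuous_extension hdense (by positivity) hα₀ hαε
      (hold t₀ ht₀ hmod₀)
    refine ⟨v, hv, ?_, fun x y => ?_⟩
    · filter_upwards [hNae] with x hx
      rw [hvu x hx]
      exact hcoe x hx
    · rcases eq_or_ne x y with rfl | hxy
      · simp
      have hd : 0 < C * dist x y ^ α x := mul_pos hC (Real.rpow_pos_of_pos (dist_pos.2 hxy) _)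
      rw [mul_right_comm, ← ENNReal.ofReal_mul hC.le]
      refine le_mul_luxNorm (by simpa using hd) ENNReal.ofReal_ne_top fun t ht hmod => ?_
      rw [← ENNReal.ofReal_mul hd.le]
      apply ENNReal.ofReal_le_ofReal
      rw [mul_right_comm]
      refine holder_bound_of_dense hdense hv hαcont hαpos (fun z hz w hw => ?_) x y
      rw [hvu z hz, hvu w hw]
      exact hold t ht hmod z hz w hw

/-! ### The empty space and the assembly -/

lemma luxNorm_of_isEmpty [IsEmpty X] [MeasurableSpace X] (μ : Measure X) (p : X → ℝ)
    (f : X → ℝ≥0∞) : luxNorm μ p f = 0 := by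
  refine le_antisymm (ENNReal.le_of_forall_pos_le_add fun ε hε _ => ?_) zero_le
  rw [zero_add]
  refine sInf_le ⟨by simpa using hε, ENNReal.coe_lt_top, ?_⟩
  simp [modular, Measure.eq_zero_of_isEmpty μ]

end VarExp

theorem mainTheorem9 (b δ D : ℝ) (hb : 0 < b) (hb1 : b ≤ 1) (hδ : 0 < δ)
    (KQ Kp Ks : VarExp.ExpBounds) :
    -- (i) the Sobolev-Poincaré inequality and its inhomogeneous version
    (∀ m ε : ℝ, 0 < ε → ∃ CS : ℝ, 0 < CS ∧
      ∀ (X : Type v) [MetricSpace X] [MeasurableSpace X] [BorelSpace X]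
        (μ : MeasureTheory.Measure X) (Q p s : X → ℝ),
        VarExp.Setting μ Q p s b δ D KQ Kp Ks →
        μ Set.univ = ENNReal.ofReal m →
        (∀ᵐ x ∂μ, ε ≤ Q x - s x * p x) →
        (∀ u ∈ VarExp.HomSobolev μ s p, ∀ g ∈ VarExp.ScalarGradients μ s u,
          VarExp.MemVarLp μ p g →
          ⨅ c : ℝ, VarExp.luxNorm μ (fun x => Q x * p x / (Q x - s x * p x)) (VarExp.absSub u c)
            ≤ ENNReal.ofReal CS * VarExp.luxNorm μ p g) ∧
        (∀ u ∈ VarExp.Sobolev μ s p, ∀ g ∈ VarExp.ScalarGradients μ s u,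
          VarExp.MemVarLp μ p g →
          VarExp.luxNorm μ (fun x => Q x * p x / (Q x - s x * p x)) (fun x => (u x).abs)
            ≤ ENNReal.ofReal CS *
              (VarExp.luxNorm μ p (fun x => (u x).abs) + VarExp.luxNorm μ p g))) ∧
    -- (ii) the Moser-Trudinger inequality
    (∃ CMT1 CMT2 : ℝ, 0 < CMT1 ∧ 0 < CMT2 ∧
      ∀ (X : Type v) [MetricSpace X] [MeasurableSpace X] [BorelSpace X]
        (μ : MeasureTheory.Measure X) (Q p s : X → ℝ),
        VarExp.Setting μ Q p s b δ D KQ Kp Ks →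
        (∀ x, s x * p x = Q x) →
        ∀ u ∈ VarExp.HomSobolev μ s p, ∀ g ∈ VarExp.ScalarGradients μ s u,
          VarExp.MemVarLp μ p g →
          MeasureTheory.Integrable (fun x => (u x).toReal) μ ∧
          (0 < VarExp.luxNorm μ p g →
            ⨍⁻ x, ENNReal.ofReal (Real.exp
                (CMT1 * (|(u x).toReal - VarExp.mean μ u| / (VarExp.luxNorm μ p g).toReal))) ∂μ
              ≤ ENNReal.ofReal CMT2)) ∧
    -- (iii) the Morrey inequality and the Hölder representative
    (∀ ε : ℝ, 0 < ε → ∃ CH DH : ℝ, 0 < CH ∧ 0 < DH ∧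
      ∀ (X : Type v) [MetricSpace X] [MeasurableSpace X] [BorelSpace X]
        (μ : MeasureTheory.Measure X) (Q p s : X → ℝ),
        VarExp.Setting μ Q p s b δ D KQ Kp Ks →
        (∀ᵐ x ∂μ, ε ≤ s x * p x - Q x) →
        ∀ u ∈ VarExp.HomSobolev μ s p, ∀ g ∈ VarExp.ScalarGradients μ s u,
          VarExp.MemVarLp μ p g →
          MeasureTheory.Integrable (fun x => (u x).toReal) μ ∧
          essSup (VarExp.absSub u (VarExp.mean μ u)) μ
            ≤ ENNReal.ofReal CH * VarExp.luxNorm μ p g ∧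
          ∃ v : X → ℝ, Continuous v ∧ (∀ᵐ x ∂μ, u x = (v x : EReal)) ∧
            ∀ x y : X, ENNReal.ofReal |v x - v y|
              ≤ ENNReal.ofReal DH * VarExp.luxNorm μ p g *
                ENNReal.ofReal (dist x y ^ (s x - Q x / p x))) := by
  refine ⟨fun m ε hε => ?_, ?_, fun ε hε => ?_⟩
  · obtain ⟨CS, hCS, H⟩ := VarExp.sobolev_inequalities.{v} hb hb1 hδ KQ Kp Ks m hε
    refine ⟨CS, hCS, fun X _ _ _ μ Q p s hset => ?_⟩
    -- The chaining needs a point to start from; on the empty space all norms and integrals vanish.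
    rcases isEmpty_or_nonempty X with hX | hX
    · intro _ _
      refine ⟨fun u _ g _ _ => (iInf_le _ 0).trans ?_, fun u _ g _ _ => ?_⟩ <;>
        simp [VarExp.luxNorm_of_isEmpty]
    · exact H X μ Q p s hset
  · obtain ⟨C₁, C₂, hC₁, hC₂, H⟩ := VarExp.moser_trudinger.{v} hb hb1 hδ KQ Kp Ks
    refine ⟨C₁, C₂, hC₁, hC₂, fun X _ _ _ μ Q p s hset => ?_⟩
    rcases isEmpty_or_nonempty X with hX | hX
    · intro _ u _ g _ _
      refine ⟨?_, ?_⟩ <;> simp [MeasureTheory.Measure.eq_zero_of_isEmpty μ]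
    · exact H X μ Q p s hset
  · obtain ⟨C₁, C₂, hC₁, hC₂, H⟩ := VarExp.morrey_inequality.{v} hb hb1 hδ KQ Kp Ks hε
    refine ⟨C₁, C₂, hC₁, hC₂, fun X _ _ _ μ Q p s hset => ?_⟩
    rcases isEmpty_or_nonempty X with hX | hX
    · intro _ u _ g _ _
      refine ⟨?_, ?_, fun _ => 0, continuous_const, ?_, isEmptyElim⟩ <;>
        simp [MeasureTheory.Measure.eq_zero_of_isEmpty μ]
    · exact H X μ Q p s hset
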